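/- **Setting.** Let $\mathcal H$ be a real Hilbert space. A bounded self-adjoint operator $A$ on a real Hilbert space is *positive* if $\langle Ax,x\rangle\ge 0$ for all $x$; for self-adjoint $A,A'$, write $A\preccurlyeq A'$ if $A'-A$ is positive; $A$ is *strictly positive* if it is positive and $c\,\mathrm{Id}\preccurlyeq A$ for some $c>0$. The set of strictly positive operators on $\mathcal H$ is denoted $\mathscr S(\mathcal H)$. Real powers $A^r$ are taken in the sense of the continuous functional calculus, and for $A,A'\in\mathscr S(\mathcal H)$ and $r\in[0,1]$, $A\#_rA'=A^{1/2}\big(A^{-1/2}A'A^{-1/2}\big)^rA^{1/2}$. A bounded linear operator $T$ is *bounded below* if there is $c>0$ with $c\|x\|\le\|Tx\|$ for all $x$. For a real Hilbert space $\mathcal G$, a bounded linear operator $L\colon\mathcal H\to\mathcal G$, a set-valued operator $B\colon\mathcal G\to2^{\mathcal G}$ and $\gamma>0$, put (with set-valued inverses) $$L^*\triangleright B=\big(L^*\circ B^{-1}\circ L\big)^{-1},\qquad L\diamond_\gamma B=L^*\triangleright\big(B+\gamma^{-1}\mathrm{Id}_{\mathcal G}\big)-\gamma^{-1}\mathrm{Id}_{\mathcal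 H},\qquad L\,\overline{\diamond}_\gamma\, B=\big(L\diamond_{1/\gamma}B^{-1}\big)^{-1}.$$ Given weights $\alpha_1,\dots,\alpha_p>0$ with $\sum_k\alpha_k=1$ and bounded linear operators $L_k$ and $C_k$ on $\mathcal H$ ($1\le k\le p$), the *resolvent comixture* is $$\mathrm{Rcm}_\gamma(L_k,C_k)_{1\le k\le p}=L\,\overline{\diamond}_\gamma\, C,$$ where $L\colon\mathcal H\to\mathcal H^p$, $x\mapsto(\sqrt{\alpha_k}L_kx)_{1\le k\le p}$, and $C\colon\mathcal H^p\to\mathcal H^p$, $(y_k)_{1\le k\le p}\mapsto(C_ky_k)_{1\le k\le p}$, with $\mathcal H^p$ the Hilbert direct sum of $p$ copies of $\mathcal H$. **Statement.** Let $p\ge1$ be an integer, $\gamma>0$, and $\alpha_1,\dots,\alpha_p>0$ with $\sum_k\alpha_k=1$. For every $k\in\{1,\dots,p\}$ let $L_k$ be a bounded linear operator on $\mathcal H$ with $0<\|L_k\|\le1$ and let $B_k\in\mathscr S(\mathcal H)$. Suppose that $L_j$ is bounded below for some $j\in\{1,\dots,p\}$, and let $s\in(0,1)$ and $t\in(-1,1)$.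 Then each of the problems $$\text{find } X\in\mathscr S(\mathcal H)\text{ such that } X=\mathrm{Rcm}_\gamma\big(L_k,\,X\#_sB_k\big)_{1\le k\le p}$$ and $$\text{find } X\in\mathscr S(\mathcal H)\text{ such that } X=\mathrm{Rcm}_\gamma\big(L_k,\,B_k^*\circ X^t\circ B_k\big)_{1\le k\le p}$$ has exactly one solution. -/

import Mathlib

/-! The continuous functional calculus for self-adjoint operators on a real Hilbert space. -/

namespace RealHilbertCFC

open Polynomial

section
variable {H : Type*} [NormedAddCommGroup H] [InnerProductSpace ℝ H] [CompleteSpace H]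

theorem isUnit_sq_add {S : H →L[ℝ] H} (hS : IsSelfAdjoint S) {d : ℝ} (hd : 0 < d) :
    IsUnit (S * S + algebraMap ℝ (H →L[ℝ] H) d) := by
  refine ContinuousLinearMap.isUnit_of_forall_le_norm_inner_map (𝕜 := ℝ) _
    (c := ⟨d, hd.le⟩) hd fun x => ?_
  have h1 : inner ℝ ((S * S + algebraMap ℝ (H →L[ℝ] H) d) x) x = ‖S x‖ ^ 2 + d * ‖x‖ ^ 2 := by
    rw [add_apply, inner_add_left, mul_apply_eq_comp,
      Algebra.algebraMap_eq_smul_one, smul_apply, inner_smul_left]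
    have h2 : inner ℝ (S (S x)) x = inner ℝ (S x) (S x) := hS.isSymmetric (S x) x
    rw [h2]
    simp
  rw [h1, Real.norm_of_nonneg (by positivity)]
  change ‖x‖ ^ 2 * d ≤ _
  nlinarith [sq_nonneg ‖S x‖]

theorem spectrum_nonempty [Nontrivial H] {a : H →L[ℝ] H} (ha : IsSelfAdjoint a) :
    (spectrum ℝ a).Nonempty := by
  by_contra hne
  rw [Set.not_nonempty_iff_eq_empty] at hne
  have h := a.spectralRadius_eq_nnnorm ha
  rw [spectralRadius, hne] at h
  simp only [Set.mem_empty_iff_false, iSup_false, iSup_bot] at h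
  have h0 : a = 0 := by simpa using h.symm
  rw [h0, spectrum.zero_eq] at hne
  simp at hne

theorem exists_root_of_irreducible {a : H →L[ℝ] H} (ha : IsSelfAdjoint a) {q : ℝ[X]}
    (hq : Irreducible q) (hu : ¬ IsUnit (aeval a q)) : ∃ x ∈ spectrum ℝ a, q.eval x = 0 := by
  have hdeg := hq.natDegree_le_two
  have hpos := hq.natDegree_pos
  by_contra! hno
  apply hu
  obtain h1 | h2 : q.natDegree = 1 ∨ q.natDegree = 2 := by omega
  · obtain ⟨c, hc, b, rfl⟩ := (Polynomial.natDegree_eq_one).1 h1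
    have hmem : -(b / c) ∉ spectrum ℝ a := fun hm => hno _ hm (by simp; field_simp; ring)
    rw [spectrum.notMem_iff, IsUnit.sub_iff] at hmem
    have : aeval a (C c * X + C b) =
        algebraMap ℝ (H →L[ℝ] H) c * (a - algebraMap ℝ (H →L[ℝ] H) (-(b / c))) := by
      simp only [map_add, map_mul, aeval_C, aeval_X, mul_sub]
      rw [← map_mul, mul_neg, mul_div_cancel₀ _ hc, map_neg, sub_neg_eq_add]
    rw [this]
    exact ((IsUnit.mk0 c hc).map (algebraMap ℝ (H →L[ℝ] H))).mul hmem
  · have hexp : q = C (q.coeff 2) * X ^ 2 + C (q.coeff 1) * X + C (q.coeff 0) := by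
      conv_lhs => rw [q.as_sum_range_C_mul_X_pow, h2]
      simp [Finset.sum_range_succ]; ring
    set u := q.coeff 2 with hu2
    set v := q.coeff 1
    set w := q.coeff 0
    have hu0 : u ≠ 0 := by
      rw [hu2, ← h2]; simpa using hq.ne_zero
    have hD : 0 < 4 * u * w - v ^ 2 := by
      by_contra hD
      obtain ⟨x, hx⟩ := exists_quadratic_eq_zero hu0
        (b := v) (c := w) ⟨Real.sqrt (discrim u v w), by
          rw [Real.mul_self_sqrt]; unfold discrim; linarith⟩
      have hroot : q.IsRoot x := by
        rw [IsRoot, hexp]; simp; linarith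
      have := Polynomial.degree_eq_one_of_irreducible_of_root hq hroot
      have h3 : q.natDegree = 1 := natDegree_eq_of_degree_eq_some this
      omega
    set S : H →L[ℝ] H := (2 * u) • a + algebraMap ℝ (H →L[ℝ] H) v
    have hS : IsSelfAdjoint S := by
      refine IsSelfAdjoint.add (IsSelfAdjoint.smul (by simp [isSelfAdjoint_iff]) ha) ?_
      exact IsSelfAdjoint.algebraMap _ (by simp [isSelfAdjoint_iff])
    have hunit := isUnit_sq_add hS hD
    have key : S * S + algebraMap ℝ (H →L[ℝ] H) (4 * u * w - v ^ 2) =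
        algebraMap ℝ (H →L[ℝ] H) (4 * u) * aeval a q := by
      rw [hexp]
      simp only [S, map_add, map_mul, aeval_C, aeval_X, map_pow, Algebra.algebraMap_eq_smul_one]
      simp only [add_mul, mul_add, smul_mul_assoc, mul_smul_comm, one_mul, mul_one, smul_smul,
        pow_two, smul_add]
      module
    rw [key] at hunit
    have h4 : IsUnit (algebraMap ℝ (H →L[ℝ] H) (4 * u)) :=
      (IsUnit.mk0 (4 * u) (by simpa using hu0)).map _
    obtain ⟨y, hy⟩ := h4
    rw [← hy] at hunit
    exact (Units.isUnit_units_mul y _).1 hunit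

theorem exists_root [Nontrivial H] {a : H →L[ℝ] H} (ha : IsSelfAdjoint a) (q : ℝ[X]) :
    ¬ IsUnit (aeval a q) → ∃ x ∈ spectrum ℝ a, q.eval x = 0 := by
  induction q using WfDvdMonoid.induction_on_irreducible with
  | zero =>
    intro _
    obtain ⟨x, hx⟩ := spectrum_nonempty ha
    exact ⟨x, hx, by simp⟩
  | unit u hu => exact fun h => (h (hu.map (aeval a))).elim
  | mul b i _ hi ih =>
    intro h
    by_cases h1 : IsUnit (aeval a i)
    · have h2 : ¬ IsUnit (aeval a b) := fun h2 => h (by rw [map_mul]; exact h1.mul h2)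
      obtain ⟨x, hx, hb⟩ := ih h2
      exact ⟨x, hx, by simp [hb]⟩
    · obtain ⟨x, hx, hb⟩ := exists_root_of_irreducible ha hi h1
      exact ⟨x, hx, by simp [hb]⟩

theorem isSelfAdjoint_aeval {a : H →L[ℝ] H} (ha : IsSelfAdjoint a) (q : ℝ[X]) :
    IsSelfAdjoint (aeval a q) := by
  induction q using Polynomial.induction_on' with
  | add p q hp hq => rw [map_add]; exact hp.add hq
  | monomial n c =>
    rw [aeval_monomial, ← Algebra.smul_def]
    exact IsSelfAdjoint.smul (by simp [isSelfAdjoint_iff]) (ha.pow n)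

theorem norm_aeval_le {a : H →L[ℝ] H} (ha : IsSelfAdjoint a) (q : ℝ[X]) :
    ‖aeval a q‖ ≤ ‖q.toContinuousMapOn (spectrum ℝ a)‖ := by
  cases subsingleton_or_nontrivial H
  · rw [Subsingleton.elim (aeval a q) 0, norm_zero]
    exact norm_nonneg (q.toContinuousMapOn (spectrum ℝ a))
  have h := (aeval a q).spectralRadius_eq_nnnorm (isSelfAdjoint_aeval ha q)
  have h2 : spectralRadius ℝ (aeval a q) ≤ ‖q.toContinuousMapOn (spectrum ℝ a)‖₊ := by
    refine iSup₂_le fun k hk => ?_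
    have : ¬ IsUnit (aeval a (q - C k)) := by
      rw [map_sub, aeval_C, ← IsUnit.sub_iff]; exact hk
    obtain ⟨x, hx, h0⟩ := exists_root ha _ this
    have h3 : q.toContinuousMapOn (spectrum ℝ a) ⟨x, hx⟩ = k := by
      simpa [sub_eq_zero] using h0
    have := (q.toContinuousMapOn (spectrum ℝ a)).norm_coe_le_norm ⟨x, hx⟩
    rw [h3] at this
    exact_mod_cast this
  rw [h] at h2
  exact_mod_cast h2

/-- The extension of `p ↦ p(a)` from polynomials to continuous functions on the spectrum. -/
noncomputable def extension (a : H →L[ℝ] H) :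
    C(spectrum ℝ a, ℝ) →L[ℝ] (H →L[ℝ] H) :=
  LinearMap.extendOfNorm (E := ℝ[X]) (Eₗ := C(spectrum ℝ a, ℝ)) (F := H →L[ℝ] H)
    (aeval a).toLinearMap (toContinuousMapOnAlgHom (spectrum ℝ a)).toLinearMap

theorem denseRange_poly (a : H →L[ℝ] H) :
    DenseRange (toContinuousMapOnAlgHom (spectrum ℝ a)) := by
  have h := polynomialFunctions.topologicalClosure (spectrum ℝ a)
  have h' := congrArg (fun S : Subalgebra ℝ C(spectrum ℝ a, ℝ) => (S : Set C(spectrum ℝ a, ℝ))) h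
  simp only [Subalgebra.topologicalClosure_coe, polynomialFunctions_coe, Algebra.coe_top] at h'
  exact dense_iff_closure_eq.2 h'

theorem extension_poly {a : H →L[ℝ] H} (ha : IsSelfAdjoint a) (q : ℝ[X]) :
    extension a (toContinuousMapOnAlgHom (spectrum ℝ a) q) = aeval a q := by
  have hb : ∃ C, ∀ q : ℝ[X], ‖(aeval a).toLinearMap q‖ ≤
      C * ‖(toContinuousMapOnAlgHom (spectrum ℝ a)).toLinearMap q‖ :=
    ⟨1, fun q => by rw [one_mul]; exact norm_aeval_le ha q⟩
  have hd : DenseRange (toContinuousMapOnAlgHom (spectrum ℝ a)).toLinearMap := denseRange_poly a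
  exact LinearMap.extendOfNorm_eq hd hb q

theorem extension_mul {a : H →L[ℝ] H} (ha : IsSelfAdjoint a) (f g : C(spectrum ℝ a, ℝ)) :
    extension a (f * g) = extension a f * extension a g := by
  refine DenseRange.induction_on₂ (denseRange_poly a)
    (p := fun f g => extension a (f * g) = extension a f * extension a g)
    (isClosed_eq (by fun_prop) (by fun_prop)) (fun p q => ?_) f g
  rw [← map_mul, extension_poly ha, extension_poly ha, extension_poly ha, map_mul]

theorem extension_isSelfAdjoint {a : H →L[ℝ] H} (ha : IsSelfAdjoint a)
    (f : C(spectrum ℝ a, ℝ)) : IsSelfAdjoint (extension a f) := by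
  refine (denseRange_poly a).induction_on (p := fun f => IsSelfAdjoint (extension a f)) f
    (isClosed_eq (by fun_prop) (by fun_prop)) fun p => ?_
  rw [extension_poly ha]
  exact isSelfAdjoint_aeval ha p

theorem extension_one {a : H →L[ℝ] H} (ha : IsSelfAdjoint a) : extension a 1 = 1 := by
  have := extension_poly ha 1
  rwa [map_one (toContinuousMapOnAlgHom (spectrum ℝ a)), map_one (aeval a)] at this

/-- The continuous functional calculus at `a`. -/
noncomputable def hom {a : H →L[ℝ] H} (ha : IsSelfAdjoint a) :
    C(spectrum ℝ a, ℝ) →⋆ₐ[ℝ] (H →L[ℝ] H) where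
  toFun := extension a
  map_one' := extension_one ha
  map_mul' := extension_mul ha
  map_zero' := map_zero _
  map_add' := map_add _
  commutes' r := by
    rw [Algebra.algebraMap_eq_smul_one, map_smul, extension_one ha, Algebra.algebraMap_eq_smul_one]
  map_star' f := by
    rw [star_trivial]
    exact (extension_isSelfAdjoint ha f).star_eq.symm

theorem norm_extension {a : H →L[ℝ] H} (ha : IsSelfAdjoint a) (f : C(spectrum ℝ a, ℝ)) :
    ‖extension a f‖ = ‖f‖ := by
  have hc : Continuous fun f : C(spectrum ℝ a, ℝ) => ‖f‖ :=
    continuous_norm (E := C(spectrum ℝ a, ℝ))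
  refine (denseRange_poly a).induction_on (p := fun f => ‖extension a f‖ = ‖f‖) f
    (isClosed_eq (extension a).continuous.norm hc) fun p => ?_
  rw [extension_poly ha]
  refine le_antisymm (norm_aeval_le ha p) ?_
  refine (ContinuousMap.norm_le _ (norm_nonneg _)).2 fun x => ?_
  have hx : p.eval x.1 ∈ spectrum ℝ (aeval a p) :=
    spectrum.subset_polynomial_aeval a p ⟨x.1, x.2, rfl⟩
  have : Nontrivial (H →L[ℝ] H) := by
    by_contra hn
    rw [not_nontrivial_iff_subsingleton] at hn
    exact hx (isUnit_of_subsingleton _)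
  simpa using spectrum.norm_le_norm_of_mem hx

theorem spectrum_extension {a : H →L[ℝ] H} (ha : IsSelfAdjoint a) (f : C(spectrum ℝ a, ℝ)) :
    spectrum ℝ (extension a f) = Set.range f := by
  apply Set.Subset.antisymm
  · rw [← ContinuousMap.spectrum_eq_range f]
    exact AlgHom.spectrum_apply_subset (hom ha) f
  · rintro _ ⟨x, rfl⟩ hx
    have hx' : IsUnit (extension a (f - algebraMap ℝ _ (f x))) := by
      rw [map_sub]
      have h1 : extension a (algebraMap ℝ _ (f x)) = algebraMap ℝ _ (f x) := (hom ha).commutes' (f x)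
      rw [h1, ← IsUnit.sub_iff]; exact hx
    obtain ⟨u, hu⟩ := hx'
    set K := ‖(↑u⁻¹ : H →L[ℝ] H)‖
    have hK : 0 ≤ K := norm_nonneg _
    set ε : ℝ := 1 / (K + 1)
    have hε : 0 < ε := by positivity
    let d : C(spectrum ℝ a, ℝ) := f - algebraMap ℝ _ (f x)
    let g : C(spectrum ℝ a, ℝ) := ⟨fun y => max 0 (1 - |d y| / ε), by fun_prop⟩
    have hdg : ‖d * g‖ ≤ ε := by
      refine (ContinuousMap.norm_le _ hε.le).2 fun y => ?_
      change ‖d y * max 0 (1 - |d y| / ε)‖ ≤ ε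
      rw [norm_mul, Real.norm_eq_abs, Real.norm_of_nonneg (le_max_left _ _)]
      rcases le_total (1 - |d y| / ε) 0 with h | h
      · rw [max_eq_left h]; simp [hε.le]
      · rw [max_eq_right h]
        have h3 : |d y| ≤ ε := by
          have : |d y| / ε ≤ 1 := by linarith
          rwa [div_le_one hε] at this
        have h4 : 0 ≤ |d y| / ε := by positivity
        nlinarith [abs_nonneg (d y)]
    have hg : 1 ≤ ‖g‖ := by
      have h5 : g x = 1 := by
        change max 0 (1 - |d x| / ε) = 1
        have : d x = 0 := by simp [d]
        simp [this]
      have := g.norm_coe_le_norm x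
      rw [h5] at this
      simpa using this
    have h6 : extension a g = ↑u⁻¹ * extension a (d * g) := by
      rw [extension_mul ha, ← hu, ← mul_assoc, Units.inv_mul, one_mul]
    have h7 : ‖g‖ ≤ K * ε := by
      rw [← norm_extension ha g, h6]
      refine (norm_mul_le _ _).trans ?_
      rw [norm_extension ha]
      gcongr
    have h8 : K * ε < 1 := by
      simp only [ε]; rw [mul_one_div, div_lt_one (by positivity)]; linarith
    linarith

/-- Bounded self-adjoint operators on a real Hilbert space have a continuous functional calculus;
through it, Mathlib's powers `A ^ t` with a real exponent are available. -/
instance instCFC : ContinuousFunctionalCalculus ℝ (H →L[ℝ] H) IsSelfAdjoint where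
  predicate_zero := IsSelfAdjoint.zero _
  spectrum_nonempty a ha := by
    have : Nontrivial H := by
      by_contra hn
      rw [not_nontrivial_iff_subsingleton] at hn
      exact not_subsingleton (H →L[ℝ] H) inferInstance
    exact RealHilbertCFC.spectrum_nonempty ha
  exists_cfc_of_predicate a ha := by
    refine ⟨hom ha, (extension a).continuous, ?_, ?_, spectrum_extension ha,
      extension_isSelfAdjoint ha⟩
    · intro f g hfg
      have h : extension a (f - g) = 0 := by
        rw [map_sub]; exact sub_eq_zero.2 hfg
      have h0 : ‖f - g‖ = 0 := by rw [← norm_extension ha, h, norm_zero]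
      exact sub_eq_zero.1 (norm_eq_zero.1 h0)
    · have := extension_poly ha X
      rw [aeval_X] at this
      refine Eq.trans ?_ this
      change extension a _ = extension a _
      congr 1
      ext x
      simp

instance instStarOrderedRing : StarOrderedRing (H →L[ℝ] H) :=
  ContinuousLinearMap.instStarOrderedRingRCLike

end
end RealHilbertCFC


namespace ResolventComposition

/-! ### Set-valued operators and resolvent compositions -/

section SetValued

variable {E F : Type*}

/-- The set-valued inverse: `x ∈ A⁻¹ y` iff `y ∈ A x`. -/
def setInv (A : E → Set F) : F → Set E := fun y => {x | y ∈ A x}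

/-- A single-valued operator regarded as a set-valued one. -/
def single (T : E → F) : E → Set F := fun x => {T x}

/-- The set-valued operator `A + c Id`. -/
def addSMulId [AddCommGroup E] [Module ℝ E] (A : E → Set E) (c : ℝ) : E → Set E :=
  fun x => (fun u => u + c • x) '' A x

end SetValued

section Composition

variable {H G : Type*} [NormedAddCommGroup H] [InnerProductSpace ℝ H] [CompleteSpace H]
  [NormedAddCommGroup G] [InnerProductSpace ℝ G] [CompleteSpace G]

/-- The parallel composition `L⋆ ▷ B = (L⋆ ∘ B⁻¹ ∘ L)⁻¹`. -/
noncomputable def parallelComp (L : H →L[ℝ] G) (B : G → Set G) : H → Set H :=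
  setInv fun x => ContinuousLinearMap.adjoint L '' setInv B (L x)

/-- The resolvent composition with parameter `γ`: `L⋆ ▷ (B + γ⁻¹ Id) - γ⁻¹ Id`. -/
noncomputable def resolventComp (γ : ℝ) (L : H →L[ℝ] G) (B : G → Set G) : H → Set H :=
  addSMulId (parallelComp L (addSMulId B γ⁻¹)) (-γ⁻¹)

/-- The resolvent cocomposition with parameter `γ`: the inverse of the resolvent composition of
`L` and `B⁻¹` with parameter `1 / γ`. -/
noncomputable def resolventCocomp (γ : ℝ) (L : H →L[ℝ] G) (B : G → Set G) : H → Set H :=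
  setInv (resolventComp (1 / γ) L (setInv B))

end Composition

/-! ### Resolvent comixtures -/

section Comixture

variable {p : ℕ} {H : Type*} [NormedAddCommGroup H] [InnerProductSpace ℝ H] [CompleteSpace H]
  {G : Fin p → Type*} [∀ k, NormedAddCommGroup (G k)] [∀ k, InnerProductSpace ℝ (G k)]
  [∀ k, CompleteSpace (G k)]

/-- The operator `x ↦ (√(α k) • L k x)_k` from `H` to the Hilbert direct sum of the `G k`. -/
noncomputable def stack (α : Fin p → ℝ) (L : ∀ k, H →L[ℝ] G k) : H →L[ℝ] PiLp 2 G :=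
  ((PiLp.continuousLinearEquiv 2 ℝ G).symm : (∀ k, G k) →L[ℝ] PiLp 2 G) ∘L
    ContinuousLinearMap.pi fun k => √(α k) • L k

/-- The block-diagonal operator `(y k)_k ↦ (B k (y k))_k` on the Hilbert direct sum. -/
noncomputable def blockDiag (B : ∀ k, G k →L[ℝ] G k) : PiLp 2 G →L[ℝ] PiLp 2 G :=
  ((PiLp.continuousLinearEquiv 2 ℝ G).symm : (∀ k, G k) →L[ℝ] PiLp 2 G) ∘L
    ContinuousLinearMap.pi fun k => B k ∘L PiLp.proj 2 G k

/-- The resolvent comixture of the families `L` and `B`, with weights `α` and parameter `γ`,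
as a set-valued operator on `H`. -/
noncomputable def comixture (γ : ℝ) (α : Fin p → ℝ) (L : ∀ k, H →L[ℝ] G k)
    (B : ∀ k, G k →L[ℝ] G k) : H → Set H :=
  resolventCocomp γ (stack α L) (single (blockDiag B))

end Comixture

/-! ### Strictly positive operators, operators bounded below, weighted geometric means -/

section Operators

variable {H G : Type*} [NormedAddCommGroup H] [InnerProductSpace ℝ H]
  [NormedAddCommGroup G] [InnerProductSpace ℝ G]

/-- `A` is self-adjoint and positive, and `c Id ≼ A` in the Löwner order for some `c > 0`. -/
def StrictlyPositive (A : H →L[ℝ] H) : Prop :=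
  A.IsPositive ∧ ∃ c : ℝ, 0 < c ∧ c • ContinuousLinearMap.id ℝ H ≤ A

/-- `L` is bounded below. -/
def BoundedBelow (L : H →L[ℝ] G) : Prop :=
  ∃ c : ℝ, 0 < c ∧ ∀ x, c * ‖x‖ ≤ ‖L x‖

/-- The `t`-weighted geometric mean `A^(1/2) ∘ (A^(-1/2) ∘ B ∘ A^(-1/2))^t ∘ A^(1/2)`, the powers
being those of the continuous functional calculus. -/
noncomputable def geomMean [CompleteSpace H] (t : ℝ) (A B : H →L[ℝ] H) : H →L[ℝ] H :=
  (A ^ (1 / 2 : ℝ)) ∘L (((A ^ (-(1 / 2) : ℝ)) ∘L B ∘L (A ^ (-(1 / 2) : ℝ))) ^ t) ∘L (A ^ (1 / 2 : ℝ))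

end Operators

end ResolventComposition

/-! Both equations are fixed-point equations for strict contractions of the Thompson metric on the
cone of strictly positive operators, where `X` and `Y` lie within `r` of each other when `X ≤ exp r
• Y` and `Y ≤ exp r • X`. The comixture itself is nonexpansive. The quadratic form of its inverse at
`x` is the minimum, over all `y` with `L⋆ y = x`, of `⟨C⁻¹ y, y⟩ + γ (‖y‖² - ‖x‖²)`
(`exists_inner_cocompInv_eq`). Since `‖L‖ ≤ 1`, the second term is nonnegative, so a bound `C ≤ c •
C'` with `c ≥ 1` passes to the cocompositions (`cocomp_le_smul_cocomp`). Boundedness below of one `L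
j` makes the compression by the stacked operator invertible. The strict contraction comes from the
inner maps. By the Löwner–Heinz inequality (`rpow_le_rpow_of_le`), `X ↦ X ^ t` contracts by `|t|`,
and congruence by `B k` keeps order bounds. Because `X #_s B = B #_{1-s} X` (`geomMean_comm`), the
mean contracts by `1 - s` in `X`. Picard iteration from the identity then converges in norm to a
strictly positive limit, which is the only fixed point (`existsUnique_fixedPoint`). -/

namespace ResolventComposition

open ContinuousLinearMap

/-! ### Löwner order and strict positivity through quadratic forms -/

section Order
variable {H : Type*} [NormedAddCommGroup H] [InnerProductSpace ℝ H] [CompleteSpace H]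

theorem le_iff_forall_inner_le {A B : H →L[ℝ] H} (hA : IsSelfAdjoint A) (hB : IsSelfAdjoint B) :
    A ≤ B ↔ ∀ x, inner ℝ (A x) x ≤ inner ℝ (B x) x := by
  rw [ContinuousLinearMap.le_def, isPositive_iff]
  constructor
  · intro h x
    have := h.2 x
    rw [sub_apply, inner_sub_left] at this
    linarith
  · intro h
    refine ⟨(hB.sub hA).isSymmetric, fun x => ?_⟩
    rw [sub_apply, inner_sub_left]
    linarith [h x]

omit [CompleteSpace H] in
theorem inner_le_of_le {A B : H →L[ℝ] H} (h : A ≤ B) (x : H) :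
    inner ℝ (A x) x ≤ inner ℝ (B x) x := by
  have := (isPositive_iff _).1 ((ContinuousLinearMap.le_def _ _).1 h) |>.2 x
  rw [sub_apply, inner_sub_left] at this
  linarith

theorem strictlyPositive_iff {A : H →L[ℝ] H} :
    StrictlyPositive A ↔ IsSelfAdjoint A ∧ ∃ c : ℝ, 0 < c ∧ ∀ x, c * ‖x‖ ^ 2 ≤ inner ℝ (A x) x := by
  have hc (c : ℝ) : IsSelfAdjoint (c • ContinuousLinearMap.id ℝ H) :=
    IsSelfAdjoint.smul (by simp [isSelfAdjoint_iff]) (IsSelfAdjoint.one _)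
  have hi (c : ℝ) (x : H) : inner ℝ ((c • ContinuousLinearMap.id ℝ H) x) x = c * ‖x‖ ^ 2 := by
    simp [inner_smul_left]
  constructor
  · rintro ⟨hA, c, hc0, h⟩
    refine ⟨hA.isSelfAdjoint, c, hc0, fun x => ?_⟩
    rw [← hi]
    exact inner_le_of_le h x
  · rintro ⟨hA, c, hc0, h⟩
    refine ⟨(isPositive_iff _).2 ⟨hA.isSymmetric, fun x => (by positivity : 0 ≤ c * ‖x‖ ^ 2).trans (h x)⟩,
      c, hc0, (le_iff_forall_inner_le (hc c) hA).2 fun x => ?_⟩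
    rw [hi]
    exact h x

theorem isUnit_of_forall_le_inner {A : H →L[ℝ] H} {c : ℝ} (hc : 0 < c)
    (h : ∀ x, c * ‖x‖ ^ 2 ≤ inner ℝ (A x) x) : IsUnit A := by
  refine isUnit_of_forall_le_norm_inner_map (𝕜 := ℝ) _ (c := ⟨c, hc.le⟩) hc fun x => ?_
  change ‖x‖ ^ 2 * c ≤ _
  rw [mul_comm]
  exact (h x).trans (le_abs_self _)

theorem nonneg_iff_forall_inner {A : H →L[ℝ] H} (hA : IsSelfAdjoint A) :
    0 ≤ A ↔ ∀ x, 0 ≤ inner ℝ (A x) x := by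
  rw [le_iff_forall_inner_le (IsSelfAdjoint.zero _) hA]
  simp

theorem StrictlyPositive.isStrictlyPositive {A : H →L[ℝ] H} (hA : StrictlyPositive A) :
    IsStrictlyPositive A := by
  obtain ⟨h, c, hc, hx⟩ := strictlyPositive_iff.1 hA
  exact ⟨(nonneg_iff_forall_inner h).2 fun x => (by positivity : 0 ≤ c * ‖x‖ ^ 2).trans (hx x),
    isUnit_of_forall_le_inner hc hx⟩

/-- The spectrum is nonnegative and omits `0` by invertibility; this yields a positive scalar lower
bound. -/
theorem _root_.IsStrictlyPositive.strictlyPositive {A : H →L[ℝ] H} (hA : IsStrictlyPositive A) :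
    StrictlyPositive A := by
  have hs : IsSelfAdjoint A := IsSelfAdjoint.of_nonneg hA.nonneg
  refine ⟨(nonneg_iff_isPositive A).1 hA.nonneg, ?_⟩
  cases subsingleton_or_nontrivial H
  · exact ⟨1, one_pos, (Subsingleton.elim _ _).le⟩
  obtain ⟨c, hc, h⟩ := (CFC.exists_pos_algebraMap_le_iff hs).2 fun x hx =>
    (spectrum_nonneg_of_nonneg hA.nonneg hx).lt_of_ne fun h0 =>
      spectrum.zero_notMem ℝ hA.isUnit (h0 ▸ hx)
  exact ⟨c, hc, by rwa [Algebra.algebraMap_eq_smul_one] at h⟩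

theorem _root_.IsStrictlyPositive.selfAdjoint {A : H →L[ℝ] H} (hA : IsStrictlyPositive A) :
    IsSelfAdjoint A := IsSelfAdjoint.of_nonneg hA.nonneg

/-- Inversion is antitone on strictly positive operators. -/
theorem inv_le_inv_of_le {A B A' B' : H →L[ℝ] H} (hA : IsSelfAdjoint A)
    (hA' : IsSelfAdjoint A') (hB' : IsSelfAdjoint B') (hA0 : 0 ≤ A)
    (hAA : A * A' = 1) (hBB : B * B' = 1) (h : A ≤ B) : B' ≤ A' := by
  rw [le_iff_forall_inner_le hB' hA']
  intro x
  have h1 : A (A' x) = x := congrArg (fun T : H →L[ℝ] H => T x) hAA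
  have h2 : B (B' x) = x := congrArg (fun T : H →L[ℝ] H => T x) hBB
  -- Positivity of the form of `A` at `A⁻¹x - B⁻¹x` expands to `2⟨B⁻¹x, x⟩ ≤ ⟨A⁻¹x, x⟩ + ⟨A B⁻¹x,
  -- B⁻¹x⟩`, and `A ≤ B` bounds the last term by `⟨B⁻¹x, x⟩`.
  have h3 := (nonneg_iff_forall_inner hA).1 hA0 (A' x - B' x)
  have h4 := inner_le_of_le h (B' x)
  have h5 : inner ℝ (A (B' x)) (A' x) = inner ℝ (B' x) x := by
    have : inner ℝ (A (B' x)) (A' x) = inner ℝ (B' x) (A (A' x)) := hA.isSymmetric _ _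
    rw [this, h1]
  rw [map_sub, inner_sub_left, inner_sub_right, inner_sub_right, h1, h5] at h3
  rw [h2] at h4
  rw [real_inner_comm (B' x) x] at *
  rw [real_inner_comm (A' x) x] at *
  linarith

theorem conj_le_conj {A B : H →L[ℝ] H} (h : A ≤ B) {T : H →L[ℝ] H} (hT : IsSelfAdjoint T) :
    T * A * T ≤ T * B * T := hT.conjugate_le_conjugate h

theorem isStrictlyPositive_conj {A T : H →L[ℝ] H} (hA : IsStrictlyPositive A)
    (hT : IsSelfAdjoint T) (hu : IsUnit T) : IsStrictlyPositive (T * A * T) :=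
  ⟨hT.conjugate_nonneg hA.nonneg, (hu.mul hA.isUnit).mul hu⟩

end Order

/-! ### Real powers and the Löwner–Heinz inequality -/

section Rpow
variable {H : Type*} [NormedAddCommGroup H] [InnerProductSpace ℝ H] [CompleteSpace H]

theorem norm_rpow_mul_rpow_neg_le_one {A B : H →L[ℝ] H} (hA : IsStrictlyPositive A)
    (hB : IsStrictlyPositive B) {s : ℝ} (h : A ^ s ≤ B ^ s) :
    ‖A ^ (s / 2) * B ^ (-(s / 2))‖ ≤ 1 := by
  refine opNorm_le_bound _ zero_le_one fun x => ?_
  rw [one_mul]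
  refine le_of_sq_le_sq ?_ (norm_nonneg x)
  set y := (B ^ (-(s / 2))) x with hy
  have hxy : (B ^ (s / 2)) y = x := by
    have := CFC.rpow_mul_rpow_neg (a := B) (s / 2) hB
    exact congrArg (fun T : H →L[ℝ] H => T x) this
  have key (C : H →L[ℝ] H) (hC : IsStrictlyPositive C) :
      ‖(C ^ (s / 2)) y‖ ^ 2 = inner ℝ ((C ^ s) y) y := by
    have h1 : C ^ s = C ^ (s / 2) * C ^ (s / 2) := by
      rw [← CFC.rpow_add hC.isUnit, add_halves]
    have h2 := (IsStrictlyPositive.rpow C (s / 2) hC).selfAdjoint.isSymmetric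
      ((C ^ (s / 2)) y) y
    rw [h1, ← real_inner_self_eq_norm_sq]
    exact h2.symm
  change ‖(A ^ (s / 2)) y‖ ^ 2 ≤ _
  rw [key A hA, ← hxy, key B hB]
  exact inner_le_of_le h y

/-- Pedersen's argument: `T = B^(-m/2) A^m B^(-m/2)` is similar to a product of two contractions,
one for each hypothesis. Its spectrum therefore lies in `[-1, 1]`; as `T` is self-adjoint, `T ≤ 1`,
and conjugating by `B^(m/2)` gives the claim. -/
theorem rpow_le_rpow_midpoint {A B : H →L[ℝ] H} (hA : IsStrictlyPositive A)
    (hB : IsStrictlyPositive B) {r s : ℝ} (hr : A ^ r ≤ B ^ r) (hs : A ^ s ≤ B ^ s) :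
    A ^ ((r + s) / 2) ≤ B ^ ((r + s) / 2) := by
  set m := (r + s) / 2 with hm
  set T := B ^ (-(m / 2)) * A ^ m * B ^ (-(m / 2)) with hT
  have hBs (q : ℝ) : IsStrictlyPositive (B ^ q) := IsStrictlyPositive.rpow B q hB
  have hAs (q : ℝ) : IsStrictlyPositive (A ^ q) := IsStrictlyPositive.rpow A q hA
  have hTp : IsStrictlyPositive T :=
    isStrictlyPositive_conj (hAs m) (hBs _).selfAdjoint (hBs _).isUnit
  have hadd (a b : ℝ) : B ^ a * B ^ b = B ^ (a + b) := (CFC.rpow_add hB.isUnit).symm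
  let S := (B ^ (-(r / 2)) * A ^ (r / 2)) * (A ^ (s / 2) * B ^ (-(s / 2)))
  have hS : ‖S‖ ≤ 1 := by
    have h1 := norm_rpow_mul_rpow_neg_le_one hA hB hs
    have h2 := norm_rpow_mul_rpow_neg_le_one hA hB hr
    rw [← norm_star, star_mul, (hAs _).selfAdjoint.star_eq, (hBs _).selfAdjoint.star_eq] at h2
    exact (norm_mul_le _ _).trans (mul_le_one₀ h2 (norm_nonneg _) h1)
  -- The exponent solves `(s - r)/4 - m/2 = -r/2` and `-m/2 - (s - r)/4 = -s/2`, so this conjugation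
  -- turns `T` into `S`.
  let u : (H →L[ℝ] H)ˣ := ⟨B ^ ((s - r) / 4), B ^ (-((s - r) / 4)),
    CFC.rpow_mul_rpow_neg _ hB, CFC.rpow_neg_mul_rpow _ hB⟩
  have hu : (u : H →L[ℝ] H) * T * (↑u⁻¹ : H →L[ℝ] H) = S := by
    change B ^ ((s - r) / 4) * T * B ^ (-((s - r) / 4)) = _
    have e1 : B ^ (-(r / 2)) = B ^ ((s - r) / 4) * B ^ (-(m / 2)) := by
      rw [hadd]; congr 1; rw [hm]; ring
    have e2 : B ^ (-(s / 2)) = B ^ (-(m / 2)) * B ^ (-((s - r) / 4)) := by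
      rw [hadd]; congr 1; rw [hm]; ring
    have e3 : A ^ m = A ^ (r / 2) * A ^ (s / 2) := by
      rw [← CFC.rpow_add hA.isUnit]; congr 1; rw [hm]; ring
    simp only [S, hT, e1, e2, e3, mul_assoc]
  have hT1 : T ≤ 1 := by
    have := le_algebraMap_of_spectrum_le (R := ℝ) (r := 1) (a := T) (fun x hx => ?_)
      hTp.selfAdjoint
    · rwa [map_one] at this
    · rw [← spectrum.units_conjugate (u := u), hu] at hx
      have h1 := spectrum.norm_le_norm_mul_of_mem hx
      refine (le_abs_self x).trans (h1.trans ?_)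
      exact mul_le_one₀ hS (norm_nonneg _) norm_id_le
  have h := conj_le_conj hT1 (hBs (m / 2)).selfAdjoint
  have e4 : B ^ (m / 2) * T * B ^ (m / 2) = A ^ m := by
    calc _ = (B ^ (m / 2) * B ^ (-(m / 2))) * A ^ m * (B ^ (-(m / 2)) * B ^ (m / 2)) := by
          simp only [hT, mul_assoc]
      _ = A ^ m := by
          rw [CFC.rpow_mul_rpow_neg _ hB, CFC.rpow_neg_mul_rpow _ hB, one_mul, mul_one]
  rwa [e4, mul_one, hadd, add_halves] at h

/-- The spectrum is compact and avoids `0`, so `x ^ r` is jointly continuous there and converges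
uniformly in `x` as `r` varies. -/
theorem continuous_rpow_exponent {A : H →L[ℝ] H} (hA : IsStrictlyPositive A) :
    Continuous fun r : ℝ => A ^ r := by
  have h0 : ∀ x ∈ spectrum ℝ A, x ≠ 0 := fun x hx h0 =>
    spectrum.zero_notMem ℝ hA.isUnit (h0 ▸ hx)
  have he : (fun r : ℝ => A ^ r) = fun r => cfc (fun x : ℝ => x ^ r) A :=
    funext fun r => CFC.rpow_eq_cfc_real hA.nonneg
  rw [he, continuous_iff_continuousAt]
  refine fun r => continuousAt_cfc_fun ?_ (.of_forall fun r x hx =>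
    (Real.continuousAt_rpow_const x r (Or.inl (h0 x hx))).continuousWithinAt)
  rw [tendstoUniformlyOn_iff_tendstoUniformly_comp_coe]
  have : CompactSpace (spectrum ℝ A) := isCompact_iff_compactSpace.1 (spectrum.isCompact A)
  refine Continuous.tendstoUniformly (fun (r : ℝ) (x : spectrum ℝ A) => (x : ℝ) ^ r) ?_ r
  exact Continuous.rpow (by fun_prop) (by fun_prop) fun p => Or.inl (h0 _ p.2.2)

theorem isClosed_nonneg_clm : IsClosed {A : H →L[ℝ] H | 0 ≤ A} := by
  have : {A : H →L[ℝ] H | 0 ≤ A} = {A | IsSelfAdjoint A} ∩ ⋂ x, {A | 0 ≤ inner ℝ (A x) x} := by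
    ext A
    simp only [Set.mem_ofPred_eq, Set.mem_inter_iff, Set.mem_iInter]
    exact ⟨fun h => ⟨.of_nonneg h, (nonneg_iff_forall_inner (.of_nonneg h)).1 h⟩,
      fun h => (nonneg_iff_forall_inner h.1).2 h.2⟩
  rw [this]
  refine IsClosed.inter (isClosed_eq continuous_star continuous_id)
    (isClosed_iInter fun x => isClosed_le continuous_const ?_)
  exact ((ContinuousLinearMap.apply ℝ H x).continuous).inner continuous_const

theorem isClosed_le_clm {X : Type*} [TopologicalSpace X] {f g : X → H →L[ℝ] H}
    (hf : Continuous f) (hg : Continuous g) : IsClosed {x | f x ≤ g x} := by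
  have : {x | f x ≤ g x} = (fun x => g x - f x) ⁻¹' {A | 0 ≤ A} := by
    ext x; simp
  rw [this]
  exact isClosed_nonneg_clm.preimage (hg.sub hf)

/-- The Löwner–Heinz inequality for strictly positive operators. -/
theorem rpow_le_rpow_of_le {A B : H →L[ℝ] H} (hA : IsStrictlyPositive A)
    (hB : IsStrictlyPositive B) (h : A ≤ B) {r : ℝ} (hr : r ∈ Set.Icc (0 : ℝ) 1) :
    A ^ r ≤ B ^ r := by
  set S := {r : ℝ | A ^ r ≤ B ^ r} with hS
  have hcl : IsClosed S := isClosed_le_clm (continuous_rpow_exponent hA) (continuous_rpow_exponent hB)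
  have h0 : (0 : ℝ) ∈ S := by
    change A ^ (0 : ℝ) ≤ B ^ (0 : ℝ)
    rw [CFC.rpow_zero _ hA.nonneg, CFC.rpow_zero _ hB.nonneg]
  have h1 : (1 : ℝ) ∈ S := by
    change A ^ (1 : ℝ) ≤ B ^ (1 : ℝ)
    rwa [CFC.rpow_one _ hA.nonneg, CFC.rpow_one _ hB.nonneg]
  -- `S` is closed, contains `0` and `1`, and is stable under midpoints. Let `a` and `b` be the
  -- members of `S` nearest to `r` from below and from above; their midpoint is in `S`, so
  -- extremality forces `r = a` or `r = b`.
  have ha := ((isCompact_Icc (a := 0) (b := r)).inter_right hcl).sSup_mem ⟨0, ⟨le_rfl, hr.1⟩, h0⟩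
  have hb := ((isCompact_Icc (a := r) (b := 1)).inter_right hcl).sInf_mem ⟨1, ⟨hr.2, le_rfl⟩, h1⟩
  set a := sSup (Set.Icc 0 r ∩ S)
  set b := sInf (Set.Icc r 1 ∩ S)
  have hm : (a + b) / 2 ∈ S := rpow_le_rpow_midpoint hA hB ha.2 hb.2
  rcases le_total ((a + b) / 2) r with hle | hle
  · have : (a + b) / 2 ≤ a :=
      le_csSup ⟨r, fun x hx => hx.1.2⟩ ⟨⟨by linarith [ha.1.1, hb.1.1, hr.1], hle⟩, hm⟩
    have : r = a := by linarith [ha.1.2, hb.1.1]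
    exact this ▸ ha.2
  · have : b ≤ (a + b) / 2 :=
      csInf_le ⟨r, fun x hx => hx.1.1⟩ ⟨⟨hle, by linarith [ha.1.2, hb.1.2, hr.2]⟩, hm⟩
    have : r = b := by linarith [ha.1.2, hb.1.1]
    exact this ▸ hb.2

theorem smul_rpow {A : H →L[ℝ] H} (hA : IsStrictlyPositive A) {c : ℝ} (hc : 0 < c) (r : ℝ) :
    (c • A) ^ r = c ^ r • A ^ r := by
  have h0 : ∀ x ∈ spectrum ℝ A, x ≠ 0 := fun x hx h0 =>
    spectrum.zero_notMem ℝ hA.isUnit (h0 ▸ hx)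
  have hcA : 0 ≤ c • A := by
    have hs : IsSelfAdjoint (c • A) := IsSelfAdjoint.smul (by simp [isSelfAdjoint_iff]) hA.selfAdjoint
    refine (nonneg_iff_forall_inner hs).2 fun x => ?_
    rw [smul_apply, inner_smul_left]
    exact mul_nonneg hc.le ((nonneg_iff_forall_inner hA.selfAdjoint).1 hA.nonneg x)
  have h1 : ContinuousOn (fun x : ℝ => x ^ r) (spectrum ℝ A) := fun x hx =>
    (Real.continuousAt_rpow_const x r (Or.inl (h0 x hx))).continuousWithinAt
  have h2 : ContinuousOn (fun x : ℝ => x ^ r) ((fun x => c • x) '' spectrum ℝ A) := by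
    rintro _ ⟨x, hx, rfl⟩
    exact (Real.continuousAt_rpow_const _ r
      (Or.inl (mul_ne_zero hc.ne' (h0 x hx)))).continuousWithinAt
  rw [CFC.rpow_eq_cfc_real hcA, CFC.rpow_eq_cfc_real hA.nonneg,
    ← cfc_comp_smul c _ A h2 hA.selfAdjoint, ← cfc_smul (c ^ r) _ A h1]
  refine cfc_congr fun x hx => ?_
  simp only [smul_eq_mul]
  exact Real.mul_rpow hc.le (spectrum_nonneg_of_nonneg hA.nonneg hx)

theorem isStrictlyPositive_smul {A : H →L[ℝ] H} (hA : IsStrictlyPositive A) {c : ℝ} (hc : 0 < c) :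
    IsStrictlyPositive (c • A) := by
  have hs : IsSelfAdjoint (c • A) := IsSelfAdjoint.smul (by simp [isSelfAdjoint_iff]) hA.selfAdjoint
  refine ⟨(nonneg_iff_forall_inner hs).2 fun x => ?_, ?_⟩
  · rw [smul_apply, inner_smul_left]
    exact mul_nonneg hc.le ((nonneg_iff_forall_inner hA.selfAdjoint).1 hA.nonneg x)
  · rw [← one_mul A, ← smul_mul_assoc, ← Algebra.algebraMap_eq_smul_one]
    exact ((IsUnit.mk0 c hc.ne').map (algebraMap ℝ (H →L[ℝ] H))).mul hA.isUnit

/-- Powers with exponent in `[0, 1]` scale the constant in an order bound. -/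
theorem rpow_le_smul_rpow {A B : H →L[ℝ] H} (hA : IsStrictlyPositive A)
    (hB : IsStrictlyPositive B) {c : ℝ} (hc : 0 < c) (h : A ≤ c • B) {r : ℝ}
    (hr : r ∈ Set.Icc (0 : ℝ) 1) : A ^ r ≤ c ^ r • B ^ r := by
  rw [← smul_rpow hB hc]
  exact rpow_le_rpow_of_le hA (isStrictlyPositive_smul hB hc) h hr

theorem smul_le_smul_clm {A B : H →L[ℝ] H} (h : A ≤ B) {c : ℝ} (hc : 0 ≤ c) : c • A ≤ c • B := by
  rw [← sub_nonneg, ← smul_sub]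
  have h' := sub_nonneg.2 h
  have hs := IsSelfAdjoint.of_nonneg h'
  refine (nonneg_iff_forall_inner (IsSelfAdjoint.smul (by simp [isSelfAdjoint_iff]) hs)).2 fun x => ?_
  rw [smul_apply, inner_smul_left]
  exact mul_nonneg hc ((nonneg_iff_forall_inner hs).1 h' x)

/-- Negative powers: the order is reversed. -/
theorem rpow_neg_le_smul_rpow_neg {A B : H →L[ℝ] H} (hA : IsStrictlyPositive A)
    (hB : IsStrictlyPositive B) {c : ℝ} (hc : 0 < c) (h : A ≤ c • B) {r : ℝ}
    (hr : r ∈ Set.Icc (0 : ℝ) 1) : B ^ (-r) ≤ c ^ r • A ^ (-r) := by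
  have h1 := rpow_le_smul_rpow hA hB hc h hr
  have hAr := IsStrictlyPositive.rpow A r hA
  have hBr := IsStrictlyPositive.rpow B r hB
  have hAn := IsStrictlyPositive.rpow A (-r) hA
  have hBn := IsStrictlyPositive.rpow B (-r) hB
  have hcr : 0 < c ^ r := Real.rpow_pos_of_pos hc r
  have h2 := inv_le_inv_of_le hAr.selfAdjoint
    hAn.selfAdjoint (isStrictlyPositive_smul hBn (inv_pos.2 hcr)).selfAdjoint hAr.nonneg
    (CFC.rpow_mul_rpow_neg r hA)
    (by rw [smul_mul_smul_comm, CFC.rpow_mul_rpow_neg r hB, mul_inv_cancel₀ hcr.ne', one_smul]) h1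
  have h3 := smul_le_smul_clm h2 hcr.le
  rwa [smul_smul, mul_inv_cancel₀ hcr.ne', one_smul] at h3
end Rpow

/-! ### Weighted geometric means -/

section GeometricMean
variable {H : Type*} [NormedAddCommGroup H] [InnerProductSpace ℝ H] [CompleteSpace H]

/-- Conjugation by a unitary is a continuous star-automorphism, hence commutes with the functional
calculus. -/
theorem rpow_unitary_conj (U : unitary (H →L[ℝ] H)) {P : H →L[ℝ] H} (hP : IsStrictlyPositive P)
    (s : ℝ) : ((U : H →L[ℝ] H) * P * star (U : H →L[ℝ] H)) ^ s =
      (U : H →L[ℝ] H) * P ^ s * star (U : H →L[ℝ] H) := by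
  have h0 : ∀ x ∈ spectrum ℝ P, x ≠ 0 := fun x hx h0 =>
    spectrum.zero_notMem ℝ hP.isUnit (h0 ▸ hx)
  let φ := Unitary.conjStarAlgAut ℝ (H →L[ℝ] H) U
  have hφ (X : H →L[ℝ] H) : φ X = (U : H →L[ℝ] H) * X * star (U : H →L[ℝ] H) := rfl
  have hn : 0 ≤ φ P := by
    rw [hφ]
    exact star_right_conjugate_nonneg hP.nonneg _
  have hc : Continuous φ := by
    change Continuous fun X : H →L[ℝ] H => (U : H →L[ℝ] H) * X * star (U : H →L[ℝ] H)
    fun_prop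
  rw [← hφ, ← hφ, CFC.rpow_eq_cfc_real hn, CFC.rpow_eq_cfc_real hP.nonneg]
  exact (StarAlgHomClass.map_cfc φ (fun x : ℝ => x ^ s) P
    (fun x hx => (Real.continuousAt_rpow_const x s (Or.inl (h0 x hx))).continuousWithinAt)
    hc hP.selfAdjoint (.of_nonneg hn)).symm

/-- Polar decomposition: with `P = T⋆T`, the operator `V = T P^(-1/2)` is unitary and `T T⋆ = V P
V⋆`. Hence `(T T⋆)^s = V P^s V⋆`, and the half powers combine to `P^(s-1)`. -/
theorem rpow_mul_star_self {T T' : H →L[ℝ] H} (h1 : T * T' = 1) (h2 : T' * T = 1) (s : ℝ) :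
    (T * star T) ^ s = T * (star T * T) ^ (s - 1) * star T := by
  set P := star T * T with hP
  have hu : IsUnit T := ⟨⟨T, T', h1, h2⟩, rfl⟩
  have hPp : IsStrictlyPositive P := ⟨star_mul_self_nonneg T, hu.star.mul hu⟩
  have hadd (a b : ℝ) : P ^ a * P ^ b = P ^ (a + b) := (CFC.rpow_add hPp.isUnit).symm
  have hsa : star (P ^ (-(1 / 2) : ℝ)) = P ^ (-(1 / 2) : ℝ) :=
    (IsStrictlyPositive.rpow P _ hPp).selfAdjoint.star_eq
  have hP1 : P ^ (1 : ℝ) = P := CFC.rpow_one _ hPp.nonneg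
  have hinv : P ^ (-1 : ℝ) * P = 1 := by
    nth_rewrite 2 [← hP1]
    rw [hadd, neg_add_cancel, CFC.rpow_zero _ hPp.nonneg]
  have hTi : P ^ (-1 : ℝ) * star T = T' := by
    calc P ^ (-1 : ℝ) * star T = P ^ (-1 : ℝ) * star T * (T * T') := by rw [h1, mul_one]
      _ = (P ^ (-1 : ℝ) * P) * T' := by rw [hP]; simp only [mul_assoc]
      _ = T' := by rw [hinv, one_mul]
  let V := T * P ^ (-(1 / 2) : ℝ)
  have hV : star V = P ^ (-(1 / 2) : ℝ) * star T := by simp only [V, star_mul, hsa]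
  have hmid (X : ℝ) : V * P ^ X * star V = T * P ^ (X - 1) * star T := by
    rw [hV]
    calc T * P ^ (-(1 / 2) : ℝ) * P ^ X * (P ^ (-(1 / 2) : ℝ) * star T)
        = T * ((P ^ (-(1 / 2) : ℝ) * P ^ X) * P ^ (-(1 / 2) : ℝ)) * star T := by
          simp only [mul_assoc]
      _ = _ := by rw [hadd, hadd, show (-(1 / 2) + X + -(1 / 2) : ℝ) = X - 1 by ring]
  have hVV : V * star V = 1 := by
    have := hmid 0
    rw [CFC.rpow_zero _ hPp.nonneg, mul_one, zero_sub, mul_assoc T (P ^ (-1 : ℝ)), hTi, h1] at this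
    exact this
  have hVV' : star V * V = 1 := by
    rw [hV]
    calc P ^ (-(1 / 2) : ℝ) * star T * (T * P ^ (-(1 / 2) : ℝ))
        = P ^ (-(1 / 2) : ℝ) * P * P ^ (-(1 / 2) : ℝ) := by rw [hP]; simp only [mul_assoc]
      _ = P ^ (-(1 / 2) : ℝ) * P ^ (1 : ℝ) * P ^ (-(1 / 2) : ℝ) := by rw [hP1]
      _ = 1 := by
        rw [hadd, hadd, show (-(1 / 2) + 1 + -(1 / 2) : ℝ) = 0 by norm_num,
          CFC.rpow_zero _ hPp.nonneg]
  have h := rpow_unitary_conj ⟨V, Unitary.mem_iff.2 ⟨hVV', hVV⟩⟩ hPp s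
  simp only [] at h
  rw [hmid s] at h
  rw [← h]
  congr 1
  have := hmid 1
  rw [hP1, sub_self, CFC.rpow_zero _ hPp.nonneg, mul_one] at this
  exact this.symm

/-- Exchanging the arguments of the geometric mean. -/
theorem geomMean_comm {A B : H →L[ℝ] H} (hA : IsStrictlyPositive A) (hB : IsStrictlyPositive B)
    (s : ℝ) : geomMean s A B = geomMean (1 - s) B A := by
  have hA' (q : ℝ) : star (A ^ q) = A ^ q := (IsStrictlyPositive.rpow A q hA).selfAdjoint.star_eq
  have hB' (q : ℝ) : star (B ^ q) = B ^ q := (IsStrictlyPositive.rpow B q hB).selfAdjoint.star_eq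
  have hAp := CFC.rpow_mul_rpow_neg (a := A) (1 / 2) hA
  have hAn := CFC.rpow_neg_mul_rpow (a := A) (1 / 2) hA
  have hBp := CFC.rpow_mul_rpow_neg (a := B) (1 / 2) hB
  have hBn := CFC.rpow_neg_mul_rpow (a := B) (1 / 2) hB
  have hAA : A ^ (1 / 2 : ℝ) * A ^ (1 / 2 : ℝ) = A := by
    rw [← CFC.rpow_add hA.isUnit, add_halves, CFC.rpow_one _ hA.nonneg]
  have hBB : B ^ (1 / 2 : ℝ) * B ^ (1 / 2 : ℝ) = B := by
    rw [← CFC.rpow_add hB.isUnit, add_halves, CFC.rpow_one _ hB.nonneg]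
  change A ^ (1 / 2 : ℝ) * ((A ^ (-(1 / 2) : ℝ) * (B * A ^ (-(1 / 2) : ℝ))) ^ s * A ^ (1 / 2 : ℝ)) =
    B ^ (1 / 2 : ℝ) * ((B ^ (-(1 / 2) : ℝ) * (A * B ^ (-(1 / 2) : ℝ))) ^ (1 - s) * B ^ (1 / 2 : ℝ))
  set a := A ^ (1 / 2 : ℝ)
  set a' := A ^ (-(1 / 2) : ℝ)
  set b := B ^ (1 / 2 : ℝ)
  set b' := B ^ (-(1 / 2) : ℝ)
  have c1 (X : H →L[ℝ] H) : a * (a' * X) = X := by rw [← mul_assoc, hAp, one_mul]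
  have c2 (X : H →L[ℝ] H) : a' * (a * X) = X := by rw [← mul_assoc, hAn, one_mul]
  have c3 (X : H →L[ℝ] H) : b * (b' * X) = X := by rw [← mul_assoc, hBp, one_mul]
  have c4 (X : H →L[ℝ] H) : b' * (b * X) = X := by rw [← mul_assoc, hBn, one_mul]
  -- With `T = A^(-1/2) B^(1/2)`, the inner factor of the left mean is `T T⋆`, while that of the
  -- right mean is `(T⋆T)⁻¹`. So `rpow_mul_star_self` relates the two, and `A^(1/2) T = B^(1/2)`
  -- supplies the outer factors.
  let T := a' * b
  let T' := b' * a
  have hTT' : T * T' = 1 := by simp only [T, T', mul_assoc, c3, hAn]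
  have hTT : T' * T = 1 := by simp only [T, T', mul_assoc, c1, hBn]
  have hTs : star T = b * a' := by simp only [T, star_mul]; rw [hA', hB']
  have hT1 : a' * (B * a') = T * star T := by
    rw [hTs, ← hBB]; simp only [T, mul_assoc]
  set Q := b' * (A * b') with hQ
  set P := star T * T with hP
  have hu : IsUnit T := ⟨⟨T, T', hTT', hTT⟩, rfl⟩
  have hPp : IsStrictlyPositive P := ⟨star_mul_self_nonneg T, hu.star.mul hu⟩
  have hQP : Q * P = 1 := by
    rw [hQ, hP, hTs, ← hAA]; simp only [T, mul_assoc, c4, c1]; exact hBn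
  have hQ' : Q = P ^ (-1 : ℝ) := by
    have h1 : P * P ^ (-1 : ℝ) = 1 := by
      nth_rewrite 1 [← CFC.rpow_one P hPp.nonneg]
      exact CFC.rpow_mul_rpow_neg 1 hPp
    calc Q = Q * (P * P ^ (-1 : ℝ)) := by rw [h1, mul_one]
      _ = _ := by rw [← mul_assoc, hQP, one_mul]
  have hTP := rpow_mul_star_self hTT' hTT s
  rw [← hP] at hTP
  rw [hT1, hTP, hQ', CFC.rpow_rpow P _ _ (by norm_num) hPp,
    show (-1 * (1 - s) : ℝ) = s - 1 by ring, hTs]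
  simp only [T, mul_assoc, c1]
  rw [hAn, mul_one]

theorem geomMean_eq_mul {A B : H →L[ℝ] H} {s : ℝ} : geomMean s A B =
    A ^ (1 / 2 : ℝ) * (A ^ (-(1 / 2) : ℝ) * B * A ^ (-(1 / 2) : ℝ)) ^ s * A ^ (1 / 2 : ℝ) := rfl

theorem isStrictlyPositive_geomMean {A B : H →L[ℝ] H} (hA : IsStrictlyPositive A)
    (hB : IsStrictlyPositive B) (s : ℝ) : IsStrictlyPositive (geomMean s A B) := by
  have h (q : ℝ) := IsStrictlyPositive.rpow A q hA
  rw [geomMean_eq_mul]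
  exact isStrictlyPositive_conj (IsStrictlyPositive.rpow _ s
    (isStrictlyPositive_conj hB (h _).selfAdjoint (h _).isUnit)) (h _).selfAdjoint (h _).isUnit

theorem geomMean_le_smul_right {A B B' : H →L[ℝ] H} (hA : IsStrictlyPositive A)
    (hB : IsStrictlyPositive B) (hB' : IsStrictlyPositive B') {c : ℝ} (hc : 0 < c)
    (h : B ≤ c • B') {s : ℝ} (hs : s ∈ Set.Icc (0 : ℝ) 1) :
    geomMean s A B ≤ c ^ s • geomMean s A B' := by
  have hp (q : ℝ) := IsStrictlyPositive.rpow A q hA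
  have h1 := conj_le_conj h (hp (-(1 / 2))).selfAdjoint
  rw [mul_smul_comm, smul_mul_assoc] at h1
  have h2 := rpow_le_smul_rpow
    (isStrictlyPositive_conj hB (hp (-(1 / 2))).selfAdjoint (hp (-(1 / 2))).isUnit)
    (isStrictlyPositive_conj hB' (hp (-(1 / 2))).selfAdjoint (hp (-(1 / 2))).isUnit) hc h1 hs
  have h3 := conj_le_conj h2 (hp (1 / 2)).selfAdjoint
  rwa [mul_smul_comm, smul_mul_assoc] at h3

/-- Exchanging the arguments moves `A` into the inner factor, where it is raised to the power `1 -
s`; this exponent is the contraction factor of the first problem. -/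
theorem geomMean_le_smul_left {A A' B : H →L[ℝ] H} (hA : IsStrictlyPositive A)
    (hA' : IsStrictlyPositive A') (hB : IsStrictlyPositive B) {c : ℝ} (hc : 0 < c)
    (h : A ≤ c • A') {s : ℝ} (hs : s ∈ Set.Icc (0 : ℝ) 1) :
    geomMean s A B ≤ c ^ (1 - s) • geomMean s A' B := by
  rw [geomMean_comm hA hB, geomMean_comm hA' hB]
  exact geomMean_le_smul_right hB hA hA' hc h ⟨by linarith [hs.2], by linarith [hs.1]⟩

end GeometricMean

/-! ### Single-valued operators among set-valued ones -/

section Single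
variable {E F : Type*}

theorem setInv_single {T : E → F} {S : F → E} (h1 : Function.LeftInverse S T)
    (h2 : Function.RightInverse S T) : setInv (single T) = single S := by
  ext y x
  change y = T x ↔ x = S y
  exact ⟨fun h => by rw [h, h1], fun h => by rw [h, h2]⟩

theorem addSMulId_single [AddCommGroup E] [Module ℝ E] (T : E → E) (c : ℝ) :
    addSMulId (single T) c = single fun x => T x + c • x := by
  ext x u
  simp [addSMulId, single]

theorem single_injective : Function.Injective (single : (E → F) → E → Set F) := by
  intro S T h
  funext x
  exact Set.singleton_injective (congrFun h x)

end Single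

/-! ### Resolvent cocompositions of strictly positive operators -/

section Cocomposition
variable {H G : Type*} [NormedAddCommGroup H] [InnerProductSpace ℝ H] [CompleteSpace H]
  [NormedAddCommGroup G] [InnerProductSpace ℝ G] [CompleteSpace G]

omit [CompleteSpace H] in
theorem setInv_single_clm {A : H →L[ℝ] H} (hA : IsUnit A) :
    setInv (single A) = single (Ring.inverse A : H →L[ℝ] H) :=
  setInv_single
    (fun x => congrArg (fun T : H →L[ℝ] H => T x) (Ring.inverse_mul_cancel A hA))
    (fun x => congrArg (fun T : H →L[ℝ] H => T x) (Ring.mul_inverse_cancel A hA))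

/-- The compression `L⋆ ∘ (C⁻¹ + γ Id)⁻¹ ∘ L`. -/
noncomputable def compression (γ : ℝ) (L : H →L[ℝ] G) (C : G →L[ℝ] G) : H →L[ℝ] H :=
  adjoint L ∘L Ring.inverse (Ring.inverse C + γ • (1 : G →L[ℝ] G)) ∘L L

/-- The inverse of the resolvent cocomposition of an invertible operator. -/
noncomputable def cocompInv (γ : ℝ) (L : H →L[ℝ] G) (C : G →L[ℝ] G) : H →L[ℝ] H :=
  Ring.inverse (compression γ L C) - γ • (1 : H →L[ℝ] H)

/-- The resolvent cocomposition of an invertible operator, as an operator. -/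
noncomputable def cocomp (γ : ℝ) (L : H →L[ℝ] G) (C : G →L[ℝ] G) : H →L[ℝ] H :=
  Ring.inverse (cocompInv γ L C)

theorem isStrictlyPositive_add_smul_one {A : H →L[ℝ] H} (hA : IsStrictlyPositive A) {γ : ℝ}
    (hγ : 0 < γ) : IsStrictlyPositive (A + γ • (1 : H →L[ℝ] H)) := by
  obtain ⟨hs, c, hc, h⟩ := strictlyPositive_iff.1 hA.strictlyPositive
  refine (strictlyPositive_iff.2 ⟨hs.add (IsSelfAdjoint.smul (by simp [isSelfAdjoint_iff])
    (IsSelfAdjoint.one _)), c, hc, fun x => ?_⟩).isStrictlyPositive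
  have h1 : inner ℝ ((A + γ • (1 : H →L[ℝ] H)) x) x = inner ℝ (A x) x + γ * ‖x‖ ^ 2 := by
    simp [inner_add_left, inner_smul_left]
  rw [h1]
  nlinarith [h x, sq_nonneg ‖x‖]

theorem isStrictlyPositive_compression {γ : ℝ} (hγ : 0 < γ) {L : H →L[ℝ] G}
    (hL : BoundedBelow L) {C : G →L[ℝ] G} (hC : IsStrictlyPositive C) :
    IsStrictlyPositive (compression γ L C) := by
  have hR := (isStrictlyPositive_add_smul_one hC.ringInverse hγ).ringInverse
  obtain ⟨hs, r, hr, h⟩ := strictlyPositive_iff.1 hR.strictlyPositive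
  obtain ⟨c, hc, hb⟩ := hL
  refine (strictlyPositive_iff.2 ⟨?_, r * c ^ 2, by positivity, fun x => ?_⟩).isStrictlyPositive
  · exact (((nonneg_iff_isPositive _).1 hR.nonneg).adjoint_conj L).isSelfAdjoint
  · change _ ≤ inner ℝ (adjoint L _) x
    rw [adjoint_inner_left]
    refine le_trans ?_ (h (L x))
    rw [mul_assoc, ← mul_pow]
    have := hb x
    gcongr

theorem cocompInv_isSelfAdjoint {γ : ℝ} (hγ : 0 < γ) {L : H →L[ℝ] G}
    (hL : BoundedBelow L) {C : G →L[ℝ] G} (hC : IsStrictlyPositive C) :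
    IsSelfAdjoint (cocompInv γ L C) :=
  (isStrictlyPositive_compression hγ hL hC).ringInverse.selfAdjoint.sub
    (IsSelfAdjoint.smul (by simp [isSelfAdjoint_iff]) (IsSelfAdjoint.one _))

theorem inner_cocompInv {γ : ℝ} {L : H →L[ℝ] G} {C : G →L[ℝ] G} (x : H) :
    inner ℝ (cocompInv γ L C x) x =
      inner ℝ (Ring.inverse (compression γ L C) x) x - γ * ‖x‖ ^ 2 := by
  simp [cocompInv, inner_sub_left, inner_smul_left]

/-- The quadratic form of the inverse cocomposition is a minimum over the fibres of `L⋆`; here the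
minimum is attained. -/
theorem exists_inner_cocompInv_eq {γ : ℝ} (hγ : 0 < γ) {L : H →L[ℝ] G}
    (hL : BoundedBelow L) {C : G →L[ℝ] G} (hC : IsStrictlyPositive C) (x : H) :
    ∃ y, adjoint L y = x ∧
      inner ℝ (cocompInv γ L C x) x =
        inner ℝ (Ring.inverse C y) y + γ * (‖y‖ ^ 2 - ‖x‖ ^ 2) ∧
      ∀ z, adjoint L z = x → inner ℝ (cocompInv γ L C x) x ≤
        inner ℝ (Ring.inverse C z) z + γ * (‖z‖ ^ 2 - ‖x‖ ^ 2) := by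
  set D := Ring.inverse C + γ • (1 : G →L[ℝ] G) with hD
  have hDp : IsStrictlyPositive D := isStrictlyPositive_add_smul_one hC.ringInverse hγ
  have hM := isStrictlyPositive_compression hγ hL hC
  set v := Ring.inverse (compression γ L C) x with hv
  -- The minimiser of `⟨D z, z⟩` subject to `L⋆ z = x`, with `v` in the role of Lagrange multiplier.
  set y := Ring.inverse D (L v) with hy
  have hDy : D y = L v :=
    congrArg (fun T : G →L[ℝ] G => T (L v)) (Ring.mul_inverse_cancel D hDp.isUnit)
  have hLy : adjoint L y = x :=
    congrArg (fun T : H →L[ℝ] H => T x) (Ring.mul_inverse_cancel _ hM.isUnit)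
  have hDf (z : G) : inner ℝ (D z) z = inner ℝ (Ring.inverse C z) z + γ * ‖z‖ ^ 2 := by
    simp [hD, inner_add_left, inner_smul_left]
  have hcross (z : G) (hz : adjoint L z = x) : inner ℝ (D y) z = inner ℝ v x := by
    rw [hDy, ← adjoint_inner_right, hz]
  refine ⟨y, hLy, ?_, fun z hz => ?_⟩
  · rw [inner_cocompInv, ← hv, ← hcross y hLy, hDf]
    ring
  · rw [inner_cocompInv, ← hv]
    -- By `hcross`, `⟨D y, z⟩` is the same for every `z` in the fibre, so `⟨D z, z⟩ - ⟨D y, y⟩ = ⟨D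
    -- (z - y), z - y⟩ ≥ 0`.
    have h1 := (nonneg_iff_forall_inner hDp.selfAdjoint).1 hDp.nonneg (z - y)
    have h2 : inner ℝ (D z) y = inner ℝ v x := by
      have : inner ℝ (D z) y = inner ℝ z (D y) := hDp.selfAdjoint.isSymmetric z y
      rw [this, real_inner_comm, hcross z hz]
    rw [map_sub, inner_sub_left, inner_sub_right, inner_sub_right, hcross z hz, hcross y hLy,
      h2, hDf] at h1
    linarith

theorem norm_adjoint_apply_le {L : H →L[ℝ] G} (hL : ‖L‖ ≤ 1) (y : G) :
    ‖adjoint L y‖ ^ 2 ≤ ‖y‖ ^ 2 := by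
  have h : ‖adjoint L y‖ ≤ 1 * ‖y‖ := by
    refine (adjoint L).le_of_opNorm_le ?_ y
    rwa [LinearIsometryEquiv.norm_map]
  rw [one_mul] at h
  gcongr

/-- At the minimiser `y` the form is at least `c ‖y‖²`, and `‖y‖ ≥ ‖L⋆ y‖ = ‖x‖` because `‖L‖ ≤ 1`.
-/
theorem isStrictlyPositive_cocompInv {γ : ℝ} (hγ : 0 < γ) {L : H →L[ℝ] G}
    (hL : BoundedBelow L) (hL1 : ‖L‖ ≤ 1) {C : G →L[ℝ] G} (hC : IsStrictlyPositive C) :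
    IsStrictlyPositive (cocompInv γ L C) := by
  obtain ⟨_, c, hc, h⟩ := strictlyPositive_iff.1 hC.ringInverse.strictlyPositive
  refine (strictlyPositive_iff.2
    ⟨cocompInv_isSelfAdjoint hγ hL hC, c, hc, fun x => ?_⟩).isStrictlyPositive
  obtain ⟨y, rfl, h1, -⟩ := exists_inner_cocompInv_eq hγ hL hC x
  rw [h1]
  have h2 := norm_adjoint_apply_le hL1 y
  nlinarith [h y]

theorem isStrictlyPositive_cocomp {γ : ℝ} (hγ : 0 < γ) {L : H →L[ℝ] G}
    (hL : BoundedBelow L) (hL1 : ‖L‖ ≤ 1) {C : G →L[ℝ] G} (hC : IsStrictlyPositive C) :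
    IsStrictlyPositive (cocomp γ L C) :=
  (isStrictlyPositive_cocompInv hγ hL hL1 hC).ringInverse

/-- Every set-valued inverse in the definition is taken of an invertible operator, so
single-valuedness persists throughout and the fixed-point problem becomes one about bounded
operators. -/
theorem resolventCocomp_single {γ : ℝ} (hγ : 0 < γ) {L : H →L[ℝ] G}
    (hL : BoundedBelow L) (hL1 : ‖L‖ ≤ 1) {C : G →L[ℝ] G} (hC : IsStrictlyPositive C) :
    resolventCocomp γ L (single C) = single (cocomp γ L C) := by
  have hD : IsStrictlyPositive (Ring.inverse C + γ • (1 : G →L[ℝ] G)) :=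
    isStrictlyPositive_add_smul_one hC.ringInverse hγ
  have h1 : addSMulId (setInv (single C)) γ =
      single (Ring.inverse C + γ • (1 : G →L[ℝ] G) : G →L[ℝ] G) := by
    rw [setInv_single_clm hC.isUnit, addSMulId_single]
    rfl
  have h2 : parallelComp L (single (Ring.inverse C + γ • (1 : G →L[ℝ] G) : G →L[ℝ] G)) =
      single (Ring.inverse (compression γ L C) : H →L[ℝ] H) := by
    rw [← setInv_single_clm (isStrictlyPositive_compression hγ hL hC).isUnit, parallelComp,
      setInv_single_clm hD.isUnit]
    congr 1
    funext x
    simp [single, compression]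
  rw [resolventCocomp, resolventComp, one_div, inv_inv, h1, h2, addSMulId_single, cocomp,
    ← setInv_single_clm (isStrictlyPositive_cocompInv hγ hL hL1 hC).isUnit]
  congr 2
  funext x
  simp [cocompInv, sub_eq_add_neg]

theorem ringInverse_le_ringInverse {A B : H →L[ℝ] H} (hA : IsStrictlyPositive A)
    (hB : IsStrictlyPositive B) (h : A ≤ B) : Ring.inverse B ≤ Ring.inverse A :=
  inv_le_inv_of_le hA.selfAdjoint hA.ringInverse.selfAdjoint hB.ringInverse.selfAdjoint hA.nonneg
    (Ring.mul_inverse_cancel A hA.isUnit) (Ring.mul_inverse_cancel B hB.isUnit) h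

theorem ringInverse_smul {A : H →L[ℝ] H} (hA : IsStrictlyPositive A) {c : ℝ} (hc : 0 < c) :
    Ring.inverse (c • A) = c⁻¹ • Ring.inverse A := by
  have h1 : c • A * c⁻¹ • Ring.inverse A = 1 := by
    rw [smul_mul_smul_comm, Ring.mul_inverse_cancel A hA.isUnit, mul_inv_cancel₀ hc.ne', one_smul]
  rw [← Ring.inverse_mul_cancel_left (c • A) (c⁻¹ • Ring.inverse A)
    (isStrictlyPositive_smul hA hc).isUnit, h1, mul_one]

theorem inner_ringInverse_le_of_le_smul {A B : H →L[ℝ] H} (hA : IsStrictlyPositive A)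
    (hB : IsStrictlyPositive B) {c : ℝ} (hc : 0 < c) (h : A ≤ c • B) (x : H) :
    inner ℝ (Ring.inverse B x) x ≤ c * inner ℝ (Ring.inverse A x) x := by
  have h1 := inner_le_of_le (ringInverse_le_ringInverse hA (isStrictlyPositive_smul hB hc) h) x
  rw [ringInverse_smul hB hc, smul_apply, inner_smul_left] at h1
  have h2 := mul_le_mul_of_nonneg_left h1 hc.le
  rwa [RCLike.conj_to_real, ← mul_assoc, mul_inv_cancel₀ hc.ne', one_mul] at h2

/-- The cocomposition does not increase order bounds by a constant at least one. -/
theorem cocomp_le_smul_cocomp {γ : ℝ} (hγ : 0 < γ) {L : H →L[ℝ] G}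
    (hL : BoundedBelow L) (hL1 : ‖L‖ ≤ 1) {C C' : G →L[ℝ] G} (hC : IsStrictlyPositive C)
    (hC' : IsStrictlyPositive C') {c : ℝ} (hc : 1 ≤ c) (h : C ≤ c • C') :
    cocomp γ L C ≤ c • cocomp γ L C' := by
  have hc0 : 0 < c := one_pos.trans_le hc
  have hW := isStrictlyPositive_cocompInv hγ hL hL1 hC
  have hW' := isStrictlyPositive_cocompInv hγ hL hL1 hC'
  have hle : cocompInv γ L C' ≤ c • cocompInv γ L C := by
    rw [le_iff_forall_inner_le hW'.selfAdjoint (isStrictlyPositive_smul hW hc0).selfAdjoint]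
    intro x
    rw [smul_apply, inner_smul_left]
    obtain ⟨y, hy, h1, -⟩ := exists_inner_cocompInv_eq hγ hL hC x
    obtain ⟨-, -, -, h2⟩ := exists_inner_cocompInv_eq hγ hL hC' x
    -- The minimiser for `C` is a competitor for `C'`. The remaining term `γ (‖y‖² - ‖x‖²)` is
    -- nonnegative, hence at most `c` times itself; this is where `c ≥ 1` enters.
    have h3 := h2 y hy
    have h4 := inner_ringInverse_le_of_le_smul hC hC' hc0 h y
    have h5 := norm_adjoint_apply_le hL1 y
    rw [hy] at h5
    have h6 : 0 ≤ γ * (‖y‖ ^ 2 - ‖x‖ ^ 2) := mul_nonneg hγ.le (sub_nonneg.2 h5)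
    change _ ≤ c * _
    rw [h1]
    nlinarith
  have h1 := ringInverse_le_ringInverse hW' (isStrictlyPositive_smul hW hc0) hle
  rw [ringInverse_smul hW hc0] at h1
  have h2 := smul_le_smul_clm h1 hc0.le
  rwa [smul_smul, mul_inv_cancel₀ hc0.ne', one_smul] at h2

end Cocomposition

/-! ### Stacked and block-diagonal operators -/

section Stack
variable {p : ℕ} {H : Type*} [NormedAddCommGroup H] [InnerProductSpace ℝ H] [CompleteSpace H]
  {G : Fin p → Type*} [∀ k, NormedAddCommGroup (G k)] [∀ k, InnerProductSpace ℝ (G k)]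
  [∀ k, CompleteSpace (G k)]

omit [CompleteSpace H] [∀ k, CompleteSpace (G k)] in
theorem norm_stack_apply_sq {α : Fin p → ℝ} (hα : ∀ k, 0 < α k) (L : ∀ k, H →L[ℝ] G k) (x : H) :
    ‖stack α L x‖ ^ 2 = ∑ k, α k * ‖L k x‖ ^ 2 := by
  rw [PiLp.norm_sq_eq_of_L2]
  refine Finset.sum_congr rfl fun k _ => ?_
  change ‖√(α k) • L k x‖ ^ 2 = _
  rw [norm_smul, mul_pow, Real.norm_of_nonneg (Real.sqrt_nonneg _), Real.sq_sqrt (hα k).le]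

omit [CompleteSpace H] [∀ k, CompleteSpace (G k)] in
theorem norm_stack_le_one {α : Fin p → ℝ} (hα : ∀ k, 0 < α k) (hα1 : ∑ k, α k = 1)
    {L : ∀ k, H →L[ℝ] G k} (hL : ∀ k, ‖L k‖ ≤ 1) : ‖stack α L‖ ≤ 1 := by
  refine opNorm_le_bound _ zero_le_one fun x => ?_
  rw [one_mul]
  refine le_of_sq_le_sq ?_ (norm_nonneg x)
  rw [norm_stack_apply_sq hα]
  calc ∑ k, α k * ‖L k x‖ ^ 2 ≤ ∑ k, α k * ‖x‖ ^ 2 := by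
        refine Finset.sum_le_sum fun k _ => mul_le_mul_of_nonneg_left ?_ (hα k).le
        have := (L k).le_of_opNorm_le (hL k) x
        rw [one_mul] at this
        gcongr
    _ = ‖x‖ ^ 2 := by rw [← Finset.sum_mul, hα1, one_mul]

omit [CompleteSpace H] [∀ k, CompleteSpace (G k)] in
theorem boundedBelow_stack {α : Fin p → ℝ} (hα : ∀ k, 0 < α k) {L : ∀ k, H →L[ℝ] G k}
    (hL : ∃ j, BoundedBelow (L j)) : BoundedBelow (stack α L) := by
  obtain ⟨j, c, hc, h⟩ := hL
  refine ⟨√(α j) * c, mul_pos (Real.sqrt_pos.2 (hα j)) hc, fun x => ?_⟩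
  refine le_of_sq_le_sq ?_ (norm_nonneg _)
  rw [norm_stack_apply_sq hα, mul_assoc, mul_pow, Real.sq_sqrt (hα j).le]
  refine le_trans ?_ (Finset.single_le_sum (f := fun k => α k * ‖L k x‖ ^ 2)
    (fun k _ => mul_nonneg (hα k).le (sq_nonneg _)) (Finset.mem_univ j))
  have := h x
  have := (hα j).le
  gcongr

omit [∀ k, CompleteSpace (G k)] in
theorem inner_blockDiag (B : ∀ k, G k →L[ℝ] G k) (x y : PiLp 2 G) :
    inner ℝ (blockDiag B x) y = ∑ k, inner ℝ (B k (x k)) (y k) := by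
  rw [PiLp.inner_apply]
  rfl

theorem isSelfAdjoint_blockDiag {B : ∀ k, G k →L[ℝ] G k} (hB : ∀ k, IsSelfAdjoint (B k)) :
    IsSelfAdjoint (blockDiag B) := by
  rw [isSelfAdjoint_iff_isSymmetric]
  intro x y
  change inner ℝ (blockDiag B x) y = inner ℝ x (blockDiag B y)
  rw [inner_blockDiag, PiLp.inner_apply]
  exact Finset.sum_congr rfl fun k _ => (hB k).isSymmetric _ _

theorem isStrictlyPositive_blockDiag {B : ∀ k, G k →L[ℝ] G k}
    (hB : ∀ k, IsStrictlyPositive (B k)) : IsStrictlyPositive (blockDiag B) := by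
  choose c hc h using fun k => (strictlyPositive_iff.1 (hB k).strictlyPositive).2
  obtain ⟨m, hm, hmc⟩ : ∃ m : ℝ, 0 < m ∧ ∀ k, m ≤ c k := by
    rcases isEmpty_or_nonempty (Fin p) with he | he
    · exact ⟨1, one_pos, fun k => he.elim k⟩
    · obtain ⟨j, hj⟩ := Finite.exists_min c
      exact ⟨c j, hc j, hj⟩
  refine (strictlyPositive_iff.2 ⟨isSelfAdjoint_blockDiag fun k => (hB k).selfAdjoint,
    m, hm, fun x => ?_⟩).isStrictlyPositive
  rw [inner_blockDiag, PiLp.norm_sq_eq_of_L2, Finset.mul_sum]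
  refine Finset.sum_le_sum fun k _ => le_trans ?_ (h k (x k))
  have := hmc k
  gcongr

theorem blockDiag_le_smul {B B' : ∀ k, G k →L[ℝ] G k}
    (hB : ∀ k, IsStrictlyPositive (B k)) (hB' : ∀ k, IsStrictlyPositive (B' k)) {c : ℝ}
    (hc : 0 < c) (h : ∀ k, B k ≤ c • B' k) : blockDiag B ≤ c • blockDiag B' := by
  rw [le_iff_forall_inner_le (isStrictlyPositive_blockDiag hB).selfAdjoint
    (isStrictlyPositive_smul (isStrictlyPositive_blockDiag hB') hc).selfAdjoint]
  intro x
  rw [smul_apply, inner_smul_left, inner_blockDiag, inner_blockDiag]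
  change _ ≤ c * _
  rw [Finset.mul_sum]
  refine Finset.sum_le_sum fun k _ => ?_
  have := inner_le_of_le (h k) (x k)
  rwa [smul_apply, inner_smul_left] at this

end Stack

open Filter Topology

/-! ### Thompson metric and its contraction principle -/

section Thompson
variable {H : Type*} [NormedAddCommGroup H] [InnerProductSpace ℝ H] [CompleteSpace H]

instance instOrderClosedTopology : OrderClosedTopology (H →L[ℝ] H) :=
  ⟨isClosed_le_clm continuous_fst continuous_snd⟩

/-- `X` and `Y` are at distance at most `r` in the Thompson metric. -/
def ThompsonLE (r : ℝ) (X Y : H →L[ℝ] H) : Prop :=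
  X ≤ Real.exp r • Y ∧ Y ≤ Real.exp r • X

omit [CompleteSpace H] in
theorem ThompsonLE.symm {r : ℝ} {X Y : H →L[ℝ] H} (h : ThompsonLE r X Y) : ThompsonLE r Y X :=
  ⟨h.2, h.1⟩

theorem ThompsonLE.trans {r s : ℝ} {X Y Z : H →L[ℝ] H} (h : ThompsonLE r X Y)
    (h' : ThompsonLE s Y Z) : ThompsonLE (r + s) X Z := by
  constructor
  · have := smul_le_smul_clm h'.1 (Real.exp_pos r).le
    rw [smul_smul, ← Real.exp_add] at this
    exact h.1.trans this
  · have := smul_le_smul_clm h.2 (Real.exp_pos s).le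
    rw [smul_smul, ← Real.exp_add, add_comm] at this
    exact h'.2.trans this

theorem smul_le_smul_of_nonneg_clm {X : H →L[ℝ] H} (hX : 0 ≤ X) {a b : ℝ} (h : a ≤ b) :
    a • X ≤ b • X := by
  rw [← sub_nonneg, ← sub_smul, ← smul_zero (b - a)]
  exact smul_le_smul_clm hX (sub_nonneg.2 h)

theorem ThompsonLE.mono {r s : ℝ} {X Y : H →L[ℝ] H} (h : ThompsonLE r X Y) (hX : 0 ≤ X)
    (hY : 0 ≤ Y) (hrs : r ≤ s) : ThompsonLE s X Y :=
  ⟨h.1.trans (smul_le_smul_of_nonneg_clm hY (Real.exp_le_exp.2 hrs)),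
    h.2.trans (smul_le_smul_of_nonneg_clm hX (Real.exp_le_exp.2 hrs))⟩

omit [CompleteSpace H] in
theorem eq_of_thompsonLE_zero {X Y : H →L[ℝ] H} (h : ThompsonLE 0 X Y) : X = Y := by
  obtain ⟨h1, h2⟩ := h
  rw [Real.exp_zero, one_smul] at h1 h2
  exact le_antisymm h1 h2

theorem ThompsonLE.of_tendsto {ι : Type*} {l : Filter ι} [l.NeBot] {r : ι → ℝ}
    {X Y : ι → H →L[ℝ] H} {r₀ : ℝ} {X₀ Y₀ : H →L[ℝ] H} (h : ∀ i, ThompsonLE (r i) (X i) (Y i))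
    (hr : Tendsto r l (𝓝 r₀)) (hX : Tendsto X l (𝓝 X₀)) (hY : Tendsto Y l (𝓝 Y₀)) :
    ThompsonLE r₀ X₀ Y₀ := by
  have he : Tendsto (fun i => Real.exp (r i)) l (𝓝 (Real.exp r₀)) :=
    (Real.continuous_exp.tendsto r₀).comp hr
  exact ⟨le_of_tendsto_of_tendsto' hX (he.smul hY) fun i => (h i).1,
    le_of_tendsto_of_tendsto' hY (he.smul hX) fun i => (h i).2⟩

/-- If `m Id ≤ B`, then `A ≤ ‖A‖ Id ≤ (‖A‖ / m) • B`, and `q ≤ exp q` avoids a logarithm. Adding the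
two ratios serves both directions at once. -/
theorem exists_thompsonLE {X Y : H →L[ℝ] H} (hX : IsStrictlyPositive X)
    (hY : IsStrictlyPositive Y) : ∃ r : ℝ, 0 ≤ r ∧ ThompsonLE r X Y := by
  obtain ⟨-, c, hc, h⟩ := strictlyPositive_iff.1 hX.strictlyPositive
  obtain ⟨-, d, hd, h'⟩ := strictlyPositive_iff.1 hY.strictlyPositive
  have key {A B : H →L[ℝ] H} (hA : IsStrictlyPositive A) (hB : IsStrictlyPositive B) {m r : ℝ}
      (hm : 0 < m) (hBm : ∀ x, m * ‖x‖ ^ 2 ≤ inner ℝ (B x) x) (hr : ‖A‖ / m ≤ r) :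
      A ≤ Real.exp r • B := by
    rw [le_iff_forall_inner_le hA.selfAdjoint
      (isStrictlyPositive_smul hB (Real.exp_pos r)).selfAdjoint]
    intro x
    rw [smul_apply, inner_smul_left]
    change _ ≤ Real.exp r * _
    have h1 : inner ℝ (A x) x ≤ ‖A‖ * ‖x‖ ^ 2 := by
      refine (real_inner_le_norm _ _).trans ?_
      rw [pow_two, ← mul_assoc]
      gcongr
      exact A.le_opNorm x
    have h2 : ‖A‖ ≤ Real.exp r * m := by
      rw [← div_le_iff₀ hm]
      linarith [Real.add_one_le_exp r]
    calc inner ℝ (A x) x ≤ Real.exp r * m * ‖x‖ ^ 2 := h1.trans (by gcongr)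
      _ ≤ _ := by rw [mul_assoc]; gcongr; exact hBm x
  have h1 : 0 ≤ ‖X‖ / d := by positivity
  have h2 : 0 ≤ ‖Y‖ / c := by positivity
  exact ⟨‖X‖ / d + ‖Y‖ / c, by positivity, key hX hY hd h' (by linarith),
    key hY hX hc h (by linarith)⟩

theorem norm_le_of_neg_le_of_le {T : H →L[ℝ] H} (hT : IsSelfAdjoint T) {K : ℝ} (hK : 0 ≤ K)
    (h1 : -(K • (1 : H →L[ℝ] H)) ≤ T) (h2 : T ≤ K • (1 : H →L[ℝ] H)) : ‖T‖ ≤ K := by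
  lift K to NNReal using hK
  rw [← Algebra.algebraMap_eq_smul_one] at h1 h2
  rw [← map_neg] at h1
  have h3 := (le_algebraMap_iff_spectrum_le hT).1 h2
  have h4 := (algebraMap_le_iff_le_spectrum hT).1 h1
  have h5 : spectralRadius ℝ T ≤ K := by
    refine iSup₂_le fun k hk => ?_
    rw [ENNReal.coe_le_coe]
    exact abs_le.2 ⟨h4 k hk, h3 k hk⟩
  rw [T.spectralRadius_eq_nnnorm hT, ENNReal.coe_le_coe] at h5
  exact h5

/-- Both differences are at most `(exp r - 1) R`. The weaker `r exp r` is linear in `r` up to a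
bounded factor, so geometric decay of Thompson distances becomes geometric decay in norm. -/
theorem ThompsonLE.norm_sub_le {r R : ℝ} (hr : 0 ≤ r) {X Y : H →L[ℝ] H} (hX : IsSelfAdjoint X)
    (hY : IsSelfAdjoint Y) (hXR : X ≤ R • (1 : H →L[ℝ] H)) (hYR : Y ≤ R • (1 : H →L[ℝ] H))
    (hR : 0 ≤ R) (h : ThompsonLE r X Y) : ‖X - Y‖ ≤ r * Real.exp r * R := by
  have he : Real.exp r - 1 ≤ r * Real.exp r := by
    have h1 := Real.add_one_le_exp (-r)
    have h2 : Real.exp (-r) * Real.exp r = 1 := by rw [← Real.exp_add]; simp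
    nlinarith [Real.exp_pos r]
  have he0 : 0 ≤ Real.exp r - 1 := by linarith [Real.add_one_le_exp r]
  have hbd {A B : H →L[ℝ] H} (hAB : A ≤ Real.exp r • B) (hB : B ≤ R • (1 : H →L[ℝ] H)) :
      A - B ≤ (r * Real.exp r * R) • (1 : H →L[ℝ] H) := by
    calc A - B ≤ Real.exp r • B - B := sub_le_sub_right hAB B
      _ = (Real.exp r - 1) • B := by rw [sub_smul, one_smul]
      _ ≤ (Real.exp r - 1) • (R • (1 : H →L[ℝ] H)) := smul_le_smul_clm hB he0
      _ = ((Real.exp r - 1) * R) • (1 : H →L[ℝ] H) := smul_smul _ _ _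
      _ ≤ _ := smul_le_smul_of_nonneg_clm zero_le_one (by gcongr)
  refine norm_le_of_neg_le_of_le (hX.sub hY) (by positivity) ?_ (hbd h.1 hYR)
  rw [← neg_sub Y X]
  exact neg_le_neg (hbd h.2 hXR)

theorem isStrictlyPositive_of_smul_one_le {X : H →L[ℝ] H} {c : ℝ} (hc : 0 < c)
    (h : c • (1 : H →L[ℝ] H) ≤ X) : IsStrictlyPositive X := by
  have h0 : 0 ≤ X := le_trans (by
    rw [← smul_zero c]; exact smul_le_smul_clm zero_le_one hc.le) h
  exact StrictlyPositive.isStrictlyPositive ⟨(nonneg_iff_isPositive X).1 h0, c, hc, h⟩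

/-- Contraction principle for the Thompson metric on strictly positive operators. -/
theorem existsUnique_fixedPoint {F : (H →L[ℝ] H) → H →L[ℝ] H}
    (hF : ∀ X, IsStrictlyPositive X → IsStrictlyPositive (F X)) {κ : ℝ} (hκ0 : 0 ≤ κ)
    (hκ1 : κ < 1) (hc : ∀ r, 0 ≤ r → ∀ X Y, IsStrictlyPositive X → IsStrictlyPositive Y →
      ThompsonLE r X Y → ThompsonLE (κ * r) (F X) (F Y)) :
    ∃! X, IsStrictlyPositive X ∧ X = F X := by
  have hκt : Tendsto (fun n : ℕ => κ ^ n) atTop (𝓝 0) := tendsto_pow_atTop_nhds_zero_of_lt_one hκ0 hκ1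
  let x : ℕ → H →L[ℝ] H := fun n => F^[n] 1
  have hxs (n : ℕ) : x (n + 1) = F (x n) := Function.iterate_succ_apply' F n 1
  have hx0 : x 0 = 1 := rfl
  have hx (n : ℕ) : IsStrictlyPositive (x n) := by
    induction n with
    | zero => exact ⟨zero_le_one, isUnit_one⟩
    | succ n ih => rw [hxs]; exact hF _ ih
  obtain ⟨r, hr, h01⟩ := exists_thompsonLE (hx 0) (hx 1)
  have hstep (n : ℕ) : ThompsonLE (κ ^ n * r) (x n) (x (n + 1)) := by
    induction n with
    | zero => simpa using h01
    | succ n ih =>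
      rw [hxs n, hxs (n + 1), pow_succ', mul_assoc]
      exact hc _ (by positivity) _ _ (hx _) (hx _) ih
  have h1κ : 0 < 1 - κ := sub_pos.2 hκ1
  set R := r / (1 - κ) with hR
  have hR0 : 0 ≤ R := by positivity
  have hdist (m n : ℕ) : ThompsonLE (κ ^ m * R) (x m) (x (m + n)) := by
    -- The exact partial geometric sum is kept so that the induction closes; the factor `1 - κ ^ n`
    -- is dropped afterwards.
    have hpre : ThompsonLE (κ ^ m * R * (1 - κ ^ n)) (x m) (x (m + n)) := by
      induction n with
      | zero => simp [ThompsonLE]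
      | succ n ih =>
        have : ThompsonLE _ (x m) (x (m + (n + 1))) := ih.trans (hstep (m + n))
        convert this using 1
        rw [hR]
        field_simp
        ring
    refine hpre.mono (hx _).nonneg (hx _).nonneg ?_
    have : 0 ≤ κ ^ m * R * κ ^ n := by positivity
    linarith
  have hbd (n : ℕ) : x n ≤ Real.exp R • (1 : H →L[ℝ] H) := by
    have := (hdist 0 n).2
    rwa [zero_add, pow_zero, one_mul] at this
  have hcauchy : CauchySeq x := by
    refine cauchySeq_of_le_geometric κ (r * Real.exp r * Real.exp R) hκ1 fun n => ?_
    rw [dist_eq_norm]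
    refine ((hstep n).norm_sub_le (by positivity) (hx _).selfAdjoint (hx _).selfAdjoint (hbd _)
      (hbd _) (Real.exp_pos _).le).trans ?_
    have h2 : κ ^ n * r ≤ r := mul_le_of_le_one_left hr (pow_le_one₀ hκ0 hκ1.le)
    have h3 := Real.exp_le_exp.2 h2
    calc κ ^ n * r * Real.exp (κ ^ n * r) * Real.exp R ≤ κ ^ n * r * Real.exp r * Real.exp R := by
          gcongr
      _ = _ := by ring
  obtain ⟨X, hX⟩ := cauchySeq_tendsto_of_complete hcauchy
  have hlim (m : ℕ) : ThompsonLE (κ ^ m * R) (x m) X :=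
    ThompsonLE.of_tendsto (hdist m) tendsto_const_nhds tendsto_const_nhds
      ((hX.comp (tendsto_add_atTop_nat m)).congr fun n => by rw [Function.comp_apply, add_comm])
  -- The uniform bound `1 ≤ exp R • X` survives the limit and keeps `X` off the boundary of the
  -- cone.
  have hXp : IsStrictlyPositive X := by
    have h1 := (hlim 0).1
    rw [pow_zero, one_mul, hx0] at h1
    refine isStrictlyPositive_of_smul_one_le (Real.exp_pos (-R)) ?_
    have h2 := smul_le_smul_clm h1 (Real.exp_pos (-R)).le
    rwa [smul_smul, ← Real.exp_add, neg_add_cancel, Real.exp_zero, one_smul] at h2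
  -- The iterate `x (m + 1) = F (x m)` tends to `X`, while its Thompson distance to `F X` is at most
  -- `κ ^ (m + 1) * R`, which tends to `0`.
  have hfix : X = F X := by
    refine eq_of_thompsonLE_zero (ThompsonLE.of_tendsto (l := atTop)
      (r := fun m => κ * (κ ^ m * R)) (Y := fun _ => F X) (fun m => ?_) ?_ (hX.comp (tendsto_add_atTop_nat 1)) tendsto_const_nhds)
    · rw [Function.comp_apply, hxs]
      exact hc _ (by positivity) _ _ (hx m) hXp (hlim m)
    · simpa using (hκt.mul_const R).const_mul κ
  refine ⟨X, ⟨hXp, hfix⟩, fun Y ⟨hYp, hY⟩ => ?_⟩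
  obtain ⟨s, hs, hYX⟩ := exists_thompsonLE hYp hXp
  have hn (n : ℕ) : ThompsonLE (κ ^ n * s) Y X := by
    induction n with
    | zero => simpa using hYX
    | succ n ih =>
      rw [hY, hfix, pow_succ', mul_assoc]
      exact hc _ (by positivity) _ _ hYp hXp ih
  exact eq_of_thompsonLE_zero (ThompsonLE.of_tendsto (l := atTop) hn
    (by simpa using hκt.mul_const s) tendsto_const_nhds tendsto_const_nhds)

end Thompson

/-! ### Fixed points of comixtures -/

section FixedPoint
variable {H : Type*} [NormedAddCommGroup H] [InnerProductSpace ℝ H] [CompleteSpace H]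

/-- Fixed-point problems for resolvent comixtures of a family of Thompson contractions. -/
theorem existsUnique_eq_comixture {p : ℕ} {γ : ℝ} (hγ : 0 < γ) {L : Fin p → H →L[ℝ] H}
    (hL : ∀ k, ‖L k‖ ≤ 1) {α : Fin p → ℝ} (hα : ∀ k, 0 < α k) (hα_sum : ∑ k, α k = 1)
    (hbelow : ∃ j, BoundedBelow (L j)) {C : Fin p → (H →L[ℝ] H) → H →L[ℝ] H}
    (hC : ∀ k X, IsStrictlyPositive X → IsStrictlyPositive (C k X)) {κ : ℝ} (hκ0 : 0 ≤ κ)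
    (hκ1 : κ < 1) (hκ : ∀ k (c : ℝ) X Y, 1 ≤ c → IsStrictlyPositive X → IsStrictlyPositive Y →
      X ≤ c • Y → Y ≤ c • X → C k X ≤ c ^ κ • C k Y) :
    ∃! X : H →L[ℝ] H, StrictlyPositive X ∧
      single X = comixture γ α L fun k => C k X := by
  have hb := boundedBelow_stack hα hbelow
  have h1 := norm_stack_le_one hα hα_sum hL
  have hD (X : H →L[ℝ] H) (hX : IsStrictlyPositive X) :
      IsStrictlyPositive (blockDiag fun k => C k X) :=
    isStrictlyPositive_blockDiag fun k => hC k X hX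
  have hle (r : ℝ) (hr : 0 ≤ r) (X Y : H →L[ℝ] H) (hX : IsStrictlyPositive X)
      (hY : IsStrictlyPositive Y) (h : ThompsonLE r X Y) :
      cocomp γ (stack α L) (blockDiag fun k => C k X) ≤
        Real.exp (κ * r) • cocomp γ (stack α L) (blockDiag fun k => C k Y) := by
    refine cocomp_le_smul_cocomp hγ hb h1 (hD X hX) (hD Y hY)
      (Real.one_le_exp (by positivity)) ?_
    refine blockDiag_le_smul (fun k => hC k X hX) (fun k => hC k Y hY) (Real.exp_pos _) fun k => ?_
    have := hκ k _ X Y (Real.one_le_exp hr) hX hY h.1 h.2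
    rwa [← Real.exp_mul, mul_comm] at this
  have := existsUnique_fixedPoint (H := H)
    (F := fun X => cocomp γ (stack α L) (blockDiag fun k => C k X))
    (fun X hX => isStrictlyPositive_cocomp hγ hb h1 (hD X hX)) hκ0 hκ1
    fun r hr X Y hX hY h => ⟨hle r hr X Y hX hY h, hle r hr Y X hY hX h.symm⟩
  refine (existsUnique_congr fun X => ?_).1 this
  constructor
  · rintro ⟨hX, h⟩
    refine ⟨hX.strictlyPositive, ?_⟩
    rw [comixture, resolventCocomp_single hγ hb h1 (hD X hX), ← h]
  · rintro ⟨hX, h⟩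
    refine ⟨hX.isStrictlyPositive, ?_⟩
    rw [comixture, resolventCocomp_single hγ hb h1 (hD X hX.isStrictlyPositive)] at h
    exact DFunLike.coe_injective (single_injective h)

end FixedPoint

end ResolventComposition

theorem corollary5p6 {H : Type*} [NormedAddCommGroup H] [InnerProductSpace ℝ H] [CompleteSpace H]
    (p : ℕ) (hp : p ≠ 0) (γ : ℝ) (hγ : 0 < γ)
    (L : Fin p → H →L[ℝ] H) (hL : ∀ k, 0 < ‖L k‖ ∧ ‖L k‖ ≤ 1)
    (B : Fin p → H →L[ℝ] H) (hB : ∀ k, ResolventComposition.StrictlyPositive (B k))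
    (α : Fin p → ℝ) (hα : ∀ k, 0 < α k) (hα_sum : ∑ k, α k = 1)
    (hbelow : ∃ j, ResolventComposition.BoundedBelow (L j))
    (s : ℝ) (hs : s ∈ Set.Ioo (0 : ℝ) 1) (t : ℝ) (ht : t ∈ Set.Ioo (-1 : ℝ) 1) :
    (∃! X : H →L[ℝ] H, ResolventComposition.StrictlyPositive X ∧
      ResolventComposition.single X = ResolventComposition.comixture γ α L
        fun k => ResolventComposition.geomMean s X (B k)) ∧
    (∃! X : H →L[ℝ] H, ResolventComposition.StrictlyPositive X ∧
      ResolventComposition.single X = ResolventComposition.comixture γ α L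
        fun k => ContinuousLinearMap.adjoint (B k) ∘L (X ^ t) ∘L B k) := by

  have hBp k := (hB k).isStrictlyPositive
  refine ⟨?_, ?_⟩
  · refine ResolventComposition.existsUnique_eq_comixture hγ (fun k => (hL k).2) hα hα_sum hbelow
      (C := fun k X => ResolventComposition.geomMean s X (B k)) (κ := 1 - s)
      (fun k X hX => ResolventComposition.isStrictlyPositive_geomMean hX (hBp k) s)
      (by linarith [hs.2]) (by linarith [hs.1]) fun k c X Y hc hX hY h _ => ?_
    exact ResolventComposition.geomMean_le_smul_left hX hY (hBp k) (one_pos.trans_le hc) h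
      ⟨hs.1.le, hs.2.le⟩
  · have hconj (k : Fin p) (X : H →L[ℝ] H) :
        ContinuousLinearMap.adjoint (B k) ∘L X ∘L B k = B k * X * B k := by
      have : ContinuousLinearMap.adjoint (B k) = B k := (hBp k).selfAdjoint
      rw [this]
      rfl
    simp only [hconj]
    refine ResolventComposition.existsUnique_eq_comixture hγ (fun k => (hL k).2) hα hα_sum hbelow
      (C := fun k X => B k * X ^ t * B k) (κ := |t|)
      (fun k X hX => ResolventComposition.isStrictlyPositive_conj (IsStrictlyPositive.rpow X t hX)
        (hBp k).selfAdjoint (hBp k).isUnit)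
      (abs_nonneg t) (abs_lt.2 ht) fun k c X Y hc hX hY h h' => ?_
    have hc0 : 0 < c := one_pos.trans_le hc
    -- A negative exponent reverses the order, so that case starts from `Y ≤ c • X` instead of `X ≤
    -- c • Y`.
    have hpow : X ^ t ≤ c ^ |t| • Y ^ t := by
      rcases le_total 0 t with h0 | h0
      · rw [abs_of_nonneg h0]
        exact ResolventComposition.rpow_le_smul_rpow hX hY hc0 h ⟨h0, ht.2.le⟩
      · have := ResolventComposition.rpow_neg_le_smul_rpow_neg hY hX hc0 h' (r := -t)
          ⟨by linarith, by linarith [ht.1]⟩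
        rwa [neg_neg, ← abs_of_nonpos h0] at this
    have := ResolventComposition.conj_le_conj hpow (hBp k).selfAdjoint
    rwa [mul_smul_comm, smul_mul_assoc] at this
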